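/- **Theorem (Accuracy Boosting).** Setting. Let $\mathcal X$ be a measurable space and $\mathcal C\subseteq\{0,1\}^{\mathcal X}$ a set of classifiers, closed under finite Boolean combinations, with the trace of the product $\sigma$-algebra, such that the evaluation $(h,x)\mapsto h(x)$ is jointly measurable (for example $\mathcal C=\{0,1\}^{\mathcal X}$ when $\mathcal X$ is countable and discrete). An $n$-sample learning rule $A$ is a Markov kernel that maps a sample $S\in(\mathcal X\times\{0,1\})^n$ to a probability distribution $A(S)$ on $\mathcal C$. Let $\mathcal D$ be a probability distribution on $\mathcal X\times\{0,1\}$ and $\mathrm{err}_{\mathcal D}(h)=\Pr_{(x,y)\sim\mathcal D}[h(x)\neq y]$. The rule $A$ is * *$\rho$-TV indistinguishable with respect to $\mathcal D$* if $\mathbf E_{S,S'\sim\mathcal D^n}[d_{\mathrm{TV}}(A(S),A(S'))]\le\rho$, where $S,S'$ are independent; * *$(\alpha,\beta)$-accurate for $\mathcal D$* if $\Pr_{S\sim\mathcal D^n,\,h\sim A(S)}[\mathrm{err}_{\mathcal D}(h)>\alpha]\le\beta$; * *absolutely continuous with respect to a probability measure $\mathcal P$ on $\mathcal C$ on inputs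 from $\mathcal D$* if $A(S)\ll\mathcal P$ for $\mathcal D^n$-almost every $S$. A *reweighting* of $\mathcal D$ is a probability distribution that has a bounded density with respect to $\mathcal D$. Let $\gamma\in(0,1)$. A weak learner $A$ with advantage $\gamma$ takes parameters $\beta,\rho$: for each choice of them it is a learning rule $A_{\beta,\rho}$ that uses $n_A(\gamma,\beta,\rho)$ examples and comes with a reference probability measure $\mathcal P_{\beta,\rho}$ on $\mathcal C$ (for example one $\mathcal P$ for all parameters). We say that $A$ is *a weak learner on $\mathcal D$* if for all $\beta,\rho\in(0,1)$ and every reweighting $\mathcal D'$ of $\mathcal D$ (including $\mathcal D$ itself), $A_{\beta,\rho}$ is (i) $\rho$-TV indistinguishable with respect to $\mathcal D'$, (ii) $(1/2-\gamma,\beta)$-accurate for $\mathcal D'$, and (iii) absolutely continuous with respect to $\mathcal P_{\beta,\rho}$ on inputs from $\mathcal D'$. Claim. There are universal constants $C,k$ such that the following holds for every such $\mathcal X$, $\mathcal C$, $\gamma$, $A$, $n_A$, $\mathcal P$ and for all $\rho',\varepsilon,\beta'\in(0,1)$. There is an $m$-sample learning rule $B$, which does not depend on the data distribution, such that for every distribution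 $\mathcal D$ on which $A$ is a weak learner, $B$ is $\rho'$-TV indistinguishable with respect to $\mathcal D$ and $(\varepsilon,\beta')$-accurate for $\mathcal D$. Its number of samples satisfies $$m\;\le\; C\left(\frac{n_A\!\left(\gamma,\ \beta'\varepsilon\gamma^2/6,\ \rho'\varepsilon\gamma^2/6\right)\log(e/\beta')}{\varepsilon^2\gamma^2}+\frac{\log(e/\beta')}{\rho'^2\,\varepsilon^3\,\gamma^2}\right)\log^k\!\left(\frac{e}{\varepsilon\gamma\rho'}\right).$$ -/

import Mathlib

open MeasureTheory ProbabilityTheory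
open scoped ENNReal NNReal

/-- A space `𝒞 ⊆ {0,1}^X` of classifiers on which learning makes measure-theoretic sense. It carries
the trace of the product σ-algebra of `{0,1}^X`. Evaluation is jointly measurable, so that
misclassification probabilities and their laws are defined, and finite Boolean combinations of
classifiers are classifiers. For a countable discrete `X` the whole of `{0,1}^X` is such a space. -/
structure IsClassifierSpace {X : Type*} [MeasurableSpace X] (𝒞 : Set (X → Bool)) : Prop where
  measurable_eval : Measurable fun p : 𝒞 × X => (p.1 : X → Bool) p.2
  boolean_closed : ∀ (k : ℕ) (φ : (Fin k → Bool) → Bool) (h : Fin k → X → Bool),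
    (∀ i, h i ∈ 𝒞) → (fun x => φ fun i => h i x) ∈ 𝒞

/-- Total variation distance `sup_E (P(E) - Q(E))`, the supremum being over the measurable sets.
The subtraction is truncated at `0`, which is harmless because `E = ∅` gives the value `0`. -/
noncomputable def tvDist {Ω : Type*} [MeasurableSpace Ω] (P Q : Measure Ω) : ℝ≥0∞ :=
  ⨆ (E : Set Ω) (_ : MeasurableSet E), P E - Q E

/-- The law `D^n` of `n` independent labelled examples from `D`. -/
noncomputable def sampleLaw {X : Type*} [MeasurableSpace X] (D : Measure (X × Bool)) (n : ℕ) :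
    Measure (Fin n → X × Bool) :=
  Measure.pi fun _ => D

/-- Misclassification probability of the classifier `h` under `D`. -/
noncomputable def err {X : Type*} [MeasurableSpace X] (D : Measure (X × Bool)) (h : X → Bool) : ℝ :=
  D.real {z | h z.1 ≠ z.2}

section LearningRule

/-! An `n`-sample learning rule is a Markov kernel from samples `S ∈ (X × {0,1})^n` to classifiers:
`A S` is the distribution of the (randomised) output on the sample `S`. -/

variable {X : Type*} [MeasurableSpace X] {𝒞 : Set (X → Bool)} {n : ℕ}

/-- `A` is `ρ`-TV indistinguishable with respect to `D`: the expected total variation distance of the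
output distributions on two independent samples is at most `ρ`. -/
def TVIndistinguishable (A : Kernel (Fin n → X × Bool) 𝒞) (D : Measure (X × Bool)) (ρ : ℝ) : Prop :=
  ∫⁻ p, tvDist (A p.1) (A p.2) ∂((sampleLaw D n).prod (sampleLaw D n)) ≤ ENNReal.ofReal ρ

/-- `A` is `(α, β)`-accurate for `D`: with probability at least `1 - β` over the sample and the
internal randomness, the output classifier errs with probability at most `α`. -/
def Accurate (A : Kernel (Fin n → X × Bool) 𝒞) (D : Measure (X × Bool)) (α β : ℝ) : Prop :=
  ∫⁻ S, A S {h : 𝒞 | α < err D (h : X → Bool)} ∂(sampleLaw D n) ≤ ENNReal.ofReal β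

/-- `A` is absolutely continuous with respect to the reference measure `P` on inputs from `D`. -/
def AbsContOn (A : Kernel (Fin n → X × Bool) 𝒞) (D : Measure (X × Bool)) (P : Measure 𝒞) : Prop :=
  ∀ᵐ S ∂(sampleLaw D n), A S ≪ P

end LearningRule

/-- `D'` is a reweighting of `D`: a probability distribution with a bounded density with respect
to `D`. -/
def IsReweighting {X : Type*} [MeasurableSpace X] (D' D : Measure (X × Bool)) : Prop :=
  IsProbabilityMeasure D' ∧ ∃ c : ℝ≥0, D' ≤ c • D

/-- The family `A β ρ` of rules is, on `D`, a weak learner with advantage `γ`: for all confidence and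
indistinguishability parameters `β, ρ ∈ (0,1)` that it is run with, and on `D` as well as on every
reweighting of `D`, it is `ρ`-TV indistinguishable, `(1/2 - γ, β)`-accurate and absolutely continuous
with respect to its reference measure. Its sample complexity is `n β ρ`. -/
def IsWeakLearnerOn {X : Type*} [MeasurableSpace X] {𝒞 : Set (X → Bool)} (γ : ℝ) {n : ℝ → ℝ → ℕ}
    (A : ∀ β ρ : ℝ, Kernel (Fin (n β ρ) → X × Bool) 𝒞) (P : ℝ → ℝ → Measure 𝒞)
    (D : Measure (X × Bool)) : Prop :=
  ∀ β ∈ Set.Ioo (0 : ℝ) 1, ∀ ρ ∈ Set.Ioo (0 : ℝ) 1, ∀ D' : Measure (X × Bool), IsReweighting D' D →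
    TVIndistinguishable (A β ρ) D' ρ ∧ Accurate (A β ρ) D' (1 / 2 - γ) β ∧
      AbsContOn (A β ρ) D' (P β ρ)

/-- The expression `N log(e/β) / (ε² γ²) + log(e/β) / (ρ² ε³ γ²)`. -/
noncomputable def boostCost (γ ε β ρ : ℝ) (N : ℕ) : ℝ :=
  N * (1 + Real.log (1 / β)) / (ε ^ 2 * γ ^ 2) + (1 + Real.log (1 / β)) / (ρ ^ 2 * ε ^ 3 * γ ^ 2)

/-! The rule is smooth boosting with a majority vote. If the correct votes on an example exceed the
wrong ones by `N`, the example has weight `((1 - γ) / (1 + γ)) ^ max N 0`, and the next vote comes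
from the weak learner run on the distribution reweighted accordingly. Examples that the majority
gets wrong have weight 1, so the mean weight (`density`) bounds the error (`err_majority_le`), and
it is safe to stop once the density is below `ε`.

Accuracy: a potential that starts at 0 and never exceeds `(1 - γ²) / (2γ)` has its mean raised by at
least `γ * density` by every vote with advantage (`avgPotential_snoc_ge`). While the density is
above `ε / 4` the potential grows by more than `γε / 4` per round, hence about `2 / (εγ²)` rounds
suffice (`lintegral_boostKernel_err_le`). Samples from the reweighted distribution come from
rejection sampling. At density above `ε / 4`, order of `n / ε` fresh examples (plus a logarithmic
term) yield `n` accepted ones up to a small failure probability (`lintegral_rejectionKernel_le`).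

Indistinguishability: two runs on independent samples are compared round by round. While their votes
coincide they face the same reweighting, so the next vote costs only the indistinguishability
parameter of the weak learner and the rejection failures. The delicate point is the decision to
stop, which depends on an empirical density. If it cost a fixed amount `c` per round, the total
would be `c` times the number `T` of rounds. Instead the stopping probability is a truncated
exponential of the empirical density, so the decisions on two samples differ by at most `c` times
(probability of stopping + `s`) (`lintegral_stopTest_sub_le`). The probabilities of stopping in the
successive rounds add up to at most 1, so the total is only `c * (1 + T * s)`
(`avgTV_boostKernel_le`). With `s` of order `1 / T`, a `c` of order `ρ'` is enough, and a test needs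
about `1 / (ρ'² ε²)` examples up to logarithms. -/

/-! ### Total variation distance: convexity, composition, measurability. -/

section TotalVariation

variable {Ω S : Type*} [MeasurableSpace Ω] [MeasurableSpace S]

lemma tvDist_le_one (P Q : Measure Ω) [IsProbabilityMeasure P] : tvDist P Q ≤ 1 :=
  iSup₂_le fun _ _ => tsub_le_self.trans prob_le_one

@[simp] lemma tvDist_self (P : Measure Ω) : tvDist P P = 0 := by
  simp [tvDist]

lemma measure_le_add_tvDist (P Q : Measure Ω) {E : Set Ω} (hE : MeasurableSet E) :
    P E ≤ Q E + tvDist P Q := by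
  have h : P E - Q E ≤ tvDist P Q := le_iSup₂ (f := fun E (_ : MeasurableSet E) => P E - Q E) E hE
  exact tsub_le_iff_left.1 h

lemma tvDist_le_of_forall {P Q : Measure Ω} {c : ℝ≥0∞}
    (h : ∀ E, MeasurableSet E → P E ≤ Q E + c) : tvDist P Q ≤ c :=
  iSup₂_le fun E hE => tsub_le_iff_left.2 (h E hE)

/-- Functions with values in `[0,1]` cannot distinguish two measures better than sets do. -/
lemma lintegral_le_add_tvDist (P Q : Measure Ω) {g : Ω → ℝ≥0∞} (hg : Measurable g)
    (hg1 : ∀ ω, g ω ≤ 1) : ∫⁻ ω, g ω ∂P ≤ ∫⁻ ω, g ω ∂Q + tvDist P Q := by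
  have hgr : ∀ ω, g ω = ENNReal.ofReal (g ω).toReal := fun ω =>
    (ENNReal.ofReal_toReal ((hg1 ω).trans_lt ENNReal.one_lt_top).ne).symm
  -- Layer cake: the bound for sets applies to every superlevel set, and averaging over levels in
  -- `(0, 1]` counts the distance exactly once.
  have key : ∀ μ : Measure Ω,
      ∫⁻ ω, g ω ∂μ = ∫⁻ t in Set.Ioc (0 : ℝ) 1, μ {ω | t < (g ω).toReal} := by
    intro μ
    rw [lintegral_congr hgr]
    rw [lintegral_eq_lintegral_meas_lt μ (f := fun ω => (g ω).toReal)
      (Filter.Eventually.of_forall fun _ => ENNReal.toReal_nonneg) hg.ennreal_toReal.aemeasurable,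
      ← Set.Ioc_union_Ioi_eq_Ioi (zero_le_one' ℝ),
      lintegral_union measurableSet_Ioi (Set.Ioc_disjoint_Ioi le_rfl)]
    have : ∫⁻ t in Set.Ioi (1 : ℝ), μ {ω | t < (g ω).toReal} = 0 := by
      refine setLIntegral_eq_zero measurableSet_Ioi fun t ht => ?_
      have : {ω | t < (g ω).toReal} = ∅ := by
        ext ω
        simp only [Set.mem_ofPred_eq, Set.mem_empty_iff_false, iff_false, not_lt]
        exact (ENNReal.toReal_mono ENNReal.one_ne_top (hg1 ω)).trans (by simpa using (le_of_lt ht))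
      simp [this]
    rw [this, add_zero]
  rw [key P, key Q]
  calc ∫⁻ t in Set.Ioc (0 : ℝ) 1, P {ω | t < (g ω).toReal}
      ≤ ∫⁻ t in Set.Ioc (0 : ℝ) 1, (Q {ω | t < (g ω).toReal} + tvDist P Q) :=
        lintegral_mono fun t => measure_le_add_tvDist P Q
          (measurableSet_lt measurable_const hg.ennreal_toReal)
    _ = _ := by
        rw [lintegral_add_right _ measurable_const]
        simp

/-- On a countably generated space the total variation distance is a countable supremum. -/
lemma exists_countable_tvDist_eq [MeasurableSpace.CountablyGenerated Ω] :
    ∃ 𝒜 : Set (Set Ω), 𝒜.Countable ∧ (∀ E ∈ 𝒜, MeasurableSet E) ∧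
      ∀ (P Q : Measure Ω) [IsFiniteMeasure P] [IsFiniteMeasure Q],
        tvDist P Q = ⨆ E ∈ 𝒜, (P E - Q E) := by
  set 𝒜 := generateSetAlgebra (MeasurableSpace.countableGeneratingSet Ω)
  have hgen : ‹MeasurableSpace Ω› = MeasurableSpace.generateFrom 𝒜 := by
    rw [generateFrom_generateSetAlgebra_eq, MeasurableSpace.generateFrom_countableGeneratingSet]
  have hmeas : ∀ E ∈ 𝒜, MeasurableSet E := fun E hE => by
    exact hgen.symm ▸ MeasurableSpace.measurableSet_generateFrom hE
  refine ⟨𝒜, countable_generateSetAlgebra MeasurableSpace.countable_countableGeneratingSet,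
    hmeas, fun P Q _ _ => le_antisymm ?_ ?_⟩
  · refine tvDist_le_of_forall fun E hE => ENNReal.le_of_forall_pos_le_add fun r hr _ => ?_
    -- Approximating with respect to `P + Q` gives one `F` that is close to `E` for both measures.
    obtain ⟨F, hF, hEF⟩ := (Measure.MeasureDense.of_generateFrom_isSetAlgebra_finite
      (μ := P + Q) isSetAlgebra_generateSetAlgebra hgen).approx E hE (measure_ne_top _ _) r hr
    have hFm := hmeas F hF
    have h1 : P E ≤ P F + P (E \ F) := by
      rw [← measure_union Set.disjoint_sdiff_right (hE.diff hFm)]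
      exact measure_mono fun x hx => by by_cases x ∈ F <;> simp_all
    have h2 : Q F ≤ Q E + Q (F \ E) := by
      rw [← measure_union Set.disjoint_sdiff_right (hFm.diff hE)]
      exact measure_mono fun x hx => by by_cases x ∈ E <;> simp_all
    have h3 : P (E \ F) + Q (F \ E) ≤ r := by
      refine le_trans ?_ (hEF.le.trans_eq ENNReal.ofReal_coe_nnreal)
      rw [Measure.add_apply]
      exact add_le_add (measure_mono Set.subset_union_left) (measure_mono Set.subset_union_right)
    have h4 : P F ≤ Q F + ⨆ E ∈ 𝒜, (P E - Q E) :=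
      tsub_le_iff_left.1 (le_iSup₂ (f := fun E (_ : E ∈ 𝒜) => P E - Q E) F hF)
    calc P E ≤ P F + P (E \ F) := h1
      _ ≤ (Q E + Q (F \ E) + ⨆ E ∈ 𝒜, (P E - Q E)) + P (E \ F) := by gcongr; exact h4.trans (by gcongr)
      _ = Q E + (⨆ E ∈ 𝒜, (P E - Q E)) + (P (E \ F) + Q (F \ E)) := by ring
      _ ≤ _ := by gcongr
  · exact iSup₂_le fun E hE =>
      le_iSup₂ (f := fun E (_ : MeasurableSet E) => P E - Q E) E (hmeas E hE)

lemma measurable_tvDist [MeasurableSpace.CountablyGenerated Ω] {S' : Type*} [MeasurableSpace S']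
    (κ η : Kernel S Ω) [IsFiniteKernel κ] [IsFiniteKernel η] {f g : S' → S}
    (hf : Measurable f) (hg : Measurable g) :
    Measurable fun s => tvDist (κ (f s)) (η (g s)) := by
  obtain ⟨𝒜, hc, hm, h⟩ := exists_countable_tvDist_eq (Ω := Ω)
  simp_rw [h]
  exact Measurable.biSup _ hc fun E hE =>
    ((κ.measurable_coe (hm E hE)).comp hf).sub ((η.measurable_coe (hm E hE)).comp hg)

/-- Total variation distance is jointly convex. -/
lemma tvDist_bind_le (κ : Kernel S Ω) [IsMarkovKernel κ] (μ ν : Measure S)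
    [IsProbabilityMeasure μ] [IsProbabilityMeasure ν] :
    tvDist (μ.bind κ) (ν.bind κ) ≤ ∫⁻ s, ∫⁻ t, tvDist (κ s) (κ t) ∂ν ∂μ := by
  refine tvDist_le_of_forall fun E hE => ?_
  have hm := κ.measurable_coe hE
  rw [Measure.bind_apply hE κ.measurable.aemeasurable, Measure.bind_apply hE κ.measurable.aemeasurable]
  -- The dummy integral couples the two inputs independently.
  calc ∫⁻ s, κ s E ∂μ = ∫⁻ s, ∫⁻ _, κ s E ∂ν ∂μ := by simp
    _ ≤ ∫⁻ s, ∫⁻ t, (κ t E + tvDist (κ s) (κ t)) ∂ν ∂μ := by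
        gcongr with s t; exact measure_le_add_tvDist _ _ hE
    _ = _ := by
        simp_rw [lintegral_add_left hm]
        rw [lintegral_add_left measurable_const]; simp

/-- Total variation distance of two-stage experiments. -/
lemma tvDist_bind_le_add (μ ν : Measure S) (κ η : Kernel S Ω) [IsMarkovKernel κ] [IsMarkovKernel η] :
    tvDist (μ.bind κ) (ν.bind η) ≤ tvDist μ ν + ∫⁻ s, tvDist (κ s) (η s) ∂μ := by
  refine tvDist_le_of_forall fun E hE => ?_
  have hm := η.measurable_coe hE
  rw [Measure.bind_apply hE κ.measurable.aemeasurable, Measure.bind_apply hE η.measurable.aemeasurable]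
  calc ∫⁻ s, κ s E ∂μ ≤ ∫⁻ s, (η s E + tvDist (κ s) (η s)) ∂μ := by
        gcongr with s; exact measure_le_add_tvDist _ _ hE
    _ = ∫⁻ s, η s E ∂μ + ∫⁻ s, tvDist (κ s) (η s) ∂μ := lintegral_add_left hm _
    _ ≤ (∫⁻ s, η s E ∂ν + tvDist μ ν) + ∫⁻ s, tvDist (κ s) (η s) ∂μ := by
        gcongr; exact lintegral_le_add_tvDist _ _ hm fun _ => prob_le_one
    _ = _ := by ring

end TotalVariation

/-! ### The σ-algebra of a classifier space is countably generated. -/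

section CountablyGenerated

/-- A measurable set of a product depends on countably many measurable sets of the first factor. -/
lemma exists_countable_measurableSet_prod {α β : Type*} [mα : MeasurableSpace α]
    [mβ : MeasurableSpace β] {s : Set (α × β)} (hs : MeasurableSet s) :
    ∃ c : Set (Set α), c.Countable ∧ (∀ t ∈ c, MeasurableSet t) ∧
      MeasurableSet[(MeasurableSpace.generateFrom c).prod mβ] s := by
  have mono : ∀ {c d : Set (Set α)}, c ⊆ d → (MeasurableSpace.generateFrom c).prod mβ ≤
      (MeasurableSpace.generateFrom d).prod mβ := fun h =>
    sup_le_sup (MeasurableSpace.comap_mono (MeasurableSpace.generateFrom_mono h)) le_rfl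
  rw [← generateFrom_prod] at hs
  induction s, hs using MeasurableSpace.generateFrom_induction with
  | hC t ht _ =>
    obtain ⟨u, hu, v, hv, rfl⟩ := ht
    refine ⟨{u}, Set.countable_singleton u, by simpa using hu, ?_⟩
    exact @MeasurableSet.prod _ _ (MeasurableSpace.generateFrom {u}) mβ _ _
      (MeasurableSpace.measurableSet_generateFrom rfl) hv
  | empty => exact ⟨∅, Set.countable_empty, by simp, @MeasurableSet.empty _ (_)⟩
  | compl t _ ih =>
    obtain ⟨c, hc, hm, h⟩ := ih
    exact ⟨c, hc, hm, h.compl⟩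
  | iUnion f _ ih =>
    choose c hc hm h using ih
    refine ⟨⋃ i, c i, Set.countable_iUnion hc, fun t ht => ?_, MeasurableSet.iUnion fun i =>
      mono (Set.subset_iUnion c i) _ (h i)⟩
    obtain ⟨i, hi⟩ := Set.mem_iUnion.1 ht
    exact hm i t hi

/-- By joint measurability, countably many sets of classifiers already make the graph of the
evaluation measurable. Its sections are the coordinate events, so these sets generate the trace
σ-algebra. This is what makes `tvDist` measurable in kernels into `𝒞`. -/
lemma IsClassifierSpace.countablyGenerated {X : Type*} [MeasurableSpace X] {𝒞 : Set (X → Bool)}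
    (h𝒞 : IsClassifierSpace 𝒞) : MeasurableSpace.CountablyGenerated 𝒞 := by
  obtain ⟨c, hc, hm, h⟩ := exists_countable_measurableSet_prod
    (h𝒞.measurable_eval (measurableSet_singleton true))
  refine ⟨c, hc, le_antisymm ?_ (MeasurableSpace.generateFrom_le hm)⟩
  change MeasurableSpace.comap Subtype.val MeasurableSpace.pi ≤ _
  rw [← measurable_iff_comap_le]
  refine @measurable_pi_lambda _ _ _ (MeasurableSpace.generateFrom c) _ _ fun x => ?_
  refine @measurable_to_bool _ (MeasurableSpace.generateFrom c) _ ?_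
  exact @measurable_prodMk_right _ _ (MeasurableSpace.generateFrom c) _ x _ h

end CountablyGenerated

attribute [local irreducible] tvDist

/-! ### Mixtures and compositions of kernels, and their average total variation. -/

section Kernels

variable {Ω S H Z : Type*} [MeasurableSpace Ω] [MeasurableSpace S] [MeasurableSpace H]
  [MeasurableSpace Z]

/-- The mixture that uses `κ` with probability `f` and `η` with probability `1 - f`. -/
noncomputable def mixKernel (f : S → ℝ≥0∞) (hf : Measurable f) (κ η : Kernel S Ω) :
    Kernel S Ω where
  toFun s := f s • κ s + (1 - f s) • η s
  measurable' := Measure.measurable_of_measurable_coe _ fun E hE => by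
    simp only [Measure.add_apply, Measure.smul_apply, smul_eq_mul]
    exact (hf.mul (κ.measurable_coe hE)).add ((measurable_const.sub hf).mul (η.measurable_coe hE))

lemma mixKernel_apply (f : S → ℝ≥0∞) (hf : Measurable f) (κ η : Kernel S Ω) (s : S) :
    mixKernel f hf κ η s = f s • κ s + (1 - f s) • η s := rfl

lemma isMarkovKernel_mixKernel {f : S → ℝ≥0∞} (hf : Measurable f) (hf1 : ∀ s, f s ≤ 1)
    (κ η : Kernel S Ω) [IsMarkovKernel κ] [IsMarkovKernel η] :
    IsMarkovKernel (mixKernel f hf κ η) :=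
  ⟨fun s => ⟨by simp [mixKernel_apply, add_tsub_cancel_of_le (hf1 s)]⟩⟩

/-- Draw `h` from `L s`, then the output from `N (h, s)`. -/
noncomputable def bindKernel (L : Kernel S H) (N : Kernel (H × S) Ω) : Kernel S Ω :=
  N ∘ₖ (L ×ₖ Kernel.id)

instance (L : Kernel S H) (N : Kernel (H × S) Ω) [IsMarkovKernel L] [IsMarkovKernel N] :
    IsMarkovKernel (bindKernel L N) := by
  unfold bindKernel; infer_instance

lemma lintegral_bindKernel (L : Kernel S H) [IsMarkovKernel L] (N : Kernel (H × S) Ω)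
    (s : S) {g : Ω → ℝ≥0∞} (hg : Measurable g) :
    ∫⁻ ω, g ω ∂(bindKernel L N s) = ∫⁻ h, ∫⁻ ω, g ω ∂(N (h, s)) ∂(L s) := by
  rw [bindKernel, Kernel.lintegral_comp _ _ _ hg, Kernel.lintegral_prod_id _ _ _]
  exact hg.lintegral_kernel

lemma bindKernel_apply (L : Kernel S H) [IsMarkovKernel L] (N : Kernel (H × S) Ω) (s : S) :
    bindKernel L N s = (L s).bind (N.comap (fun h => (h, s)) measurable_prodMk_right) := by
  ext E hE
  rw [Measure.bind_apply hE (Kernel.measurable _).aemeasurable, ← lintegral_indicator_one hE,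
    lintegral_bindKernel _ _ _ (measurable_one.indicator hE)]
  simp [lintegral_indicator_one hE, Kernel.comap_apply]

/-- Expected total variation distance of the outputs on two independent inputs. -/
noncomputable def avgTV (κ : Kernel S Ω) (μ : Measure S) : ℝ≥0∞ :=
  ∫⁻ s, ∫⁻ t, tvDist (κ s) (κ t) ∂μ ∂μ

lemma avgTV_le_one (κ : Kernel S Ω) [IsMarkovKernel κ] (μ : Measure S) [IsProbabilityMeasure μ] :
    avgTV κ μ ≤ 1 := by
  calc avgTV κ μ ≤ ∫⁻ _, ∫⁻ _, 1 ∂μ ∂μ := by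
        unfold avgTV; gcongr; exact tvDist_le_one _ _
    _ = 1 := by simp

/-- The component `R` is common to both mixtures, so only the mismatch of the weights and the
distance of the other components count. The factor `1 - a` must survive for the costs of the
stopping tests to telescope later. -/
lemma tvDist_mix_le {a b : ℝ≥0∞} (hb : b ≤ 1) (R P Q : Measure Ω)
    [IsProbabilityMeasure R] [IsProbabilityMeasure Q] :
    tvDist (a • R + (1 - a) • P) (b • R + (1 - b) • Q) ≤
      ((a - b) + (b - a)) + (1 - a) * tvDist P Q := by
  refine tvDist_le_of_forall fun E hE => ?_
  simp only [Measure.add_apply, Measure.smul_apply, smul_eq_mul]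
  have h1 : a ≤ b + (a - b) := le_add_tsub
  have h2 : 1 - a ≤ (1 - b) + (b - a) := by
    rw [tsub_le_iff_left]
    calc (1 : ℝ≥0∞) = b + (1 - b) := (add_tsub_cancel_of_le hb).symm
      _ ≤ (a + (b - a)) + (1 - b) := by gcongr; exact le_add_tsub
      _ = _ := by ring
  have hR : R E ≤ 1 := prob_le_one
  have hQ : Q E ≤ 1 := prob_le_one
  calc a * R E + (1 - a) * P E
      ≤ (b + (a - b)) * R E + (1 - a) * (Q E + tvDist P Q) := by
        gcongr; exact measure_le_add_tvDist P Q hE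
    _ = b * R E + (a - b) * R E + (1 - a) * Q E + (1 - a) * tvDist P Q := by ring
    _ ≤ b * R E + (a - b) * 1 + ((1 - b) + (b - a)) * Q E + (1 - a) * tvDist P Q := by gcongr
    _ = b * R E + (a - b) * 1 + (1 - b) * Q E + (b - a) * Q E + (1 - a) * tvDist P Q := by ring
    _ ≤ b * R E + (a - b) * 1 + (1 - b) * Q E + (b - a) * 1 + (1 - a) * tvDist P Q := by gcongr
    _ = _ := by ring

variable [MeasurableSpace.CountablyGenerated Ω]

lemma avgTV_comap (κ : Kernel S Ω) [IsMarkovKernel κ] {φ : Z → S} {ν : Measure Z} {μ : Measure S}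
    [SFinite μ] (hφ : MeasurePreserving φ ν μ) :
    avgTV (κ.comap φ hφ.measurable) ν = avgTV κ μ := by
  simp only [avgTV, Kernel.comap_apply]
  have h := measurable_tvDist κ κ (S' := S × S) measurable_fst measurable_snd
  rw [← hφ.lintegral_comp (f := fun s => ∫⁻ t, tvDist (κ s) (κ t) ∂μ) h.lintegral_prod_right']
  refine lintegral_congr fun z => ?_
  rw [hφ.lintegral_comp (f := fun t => tvDist (κ (φ z)) (κ t)) (h.comp measurable_prodMk_left)]

/-- This models a stopping test on fresh data `z`: `R` is the output on stopping, `η` the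
continuation on further data. -/
lemma avgTV_mix_le (κ : Kernel (Z × S) Ω) [IsMarkovKernel κ] (η : Kernel S Ω) [IsMarkovKernel η]
    {f : Z → ℝ≥0∞} (hf : Measurable f) (hf1 : ∀ z, f z ≤ 1) (R : Measure Ω)
    [IsProbabilityMeasure R] (h : ∀ z s, κ (z, s) = f z • R + (1 - f z) • η s)
    (ν : Measure Z) (μ : Measure S) [IsProbabilityMeasure ν] [IsProbabilityMeasure μ] :
    avgTV κ (ν.prod μ) ≤ ∫⁻ z, ∫⁻ z', ((f z - f z') + (f z' - f z)) ∂ν ∂ν +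
      (∫⁻ z, (1 - f z) ∂ν) * avgTV η μ := by
  have hκ := measurable_tvDist κ κ (S' := (Z × S) × (Z × S)) measurable_fst measurable_snd
  have hη := measurable_tvDist η η (S' := S × S) measurable_fst measurable_snd
  have hd : Measurable fun p : Z × Z => (f p.1 - f p.2) + (f p.2 - f p.1) := by fun_prop
  have hd' : ∀ z, Measurable fun z' => (f z - f z') + (f z' - f z) := fun z => by fun_prop
  calc avgTV κ (ν.prod μ)
      = ∫⁻ z, ∫⁻ s, ∫⁻ z', ∫⁻ s', tvDist (κ (z, s)) (κ (z', s')) ∂μ ∂ν ∂μ ∂ν := by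
        rw [avgTV, lintegral_prod _ hκ.lintegral_prod_right'.aemeasurable]
        refine lintegral_congr fun z => lintegral_congr fun s => ?_
        rw [lintegral_prod _ (by exact (hκ.comp measurable_prodMk_left).aemeasurable)]
    _ ≤ ∫⁻ z, ∫⁻ s, ∫⁻ z', ∫⁻ s', (((f z - f z') + (f z' - f z)) +
          (1 - f z) * tvDist (η s) (η s')) ∂μ ∂ν ∂μ ∂ν := by
        gcongr with z s z' s'
        rw [h, h]
        exact tvDist_mix_le (hf1 z') _ _ _
    _ = ∫⁻ z, (∫⁻ z', ((f z - f z') + (f z' - f z)) ∂ν + (1 - f z) * avgTV η μ) ∂ν := by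
        refine lintegral_congr fun z => ?_
        have : ∀ s, Measurable fun s' => tvDist (η s) (η s') := fun s =>
          hη.comp measurable_prodMk_left
        simp_rw [lintegral_add_left measurable_const, lintegral_const, measure_univ, mul_one,
          lintegral_const_mul _ (this _)]
        simp_rw [lintegral_add_left (hd' z), lintegral_const, measure_univ, mul_one]
        rw [lintegral_add_left measurable_const, lintegral_const_mul _ hη.lintegral_prod_right']
        simp [avgTV]
    _ = _ := by
        rw [lintegral_add_left hd.lintegral_prod_right', lintegral_mul_const _ (by fun_prop)]

/-- Chain rule: after paying for the disagreement of the intermediate values, the second stage may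
be compared with the same `h` on both sides, and only its dependence on the fresh data remains. -/
lemma avgTV_bind_le (κ : Kernel (Z × S) Ω) [IsMarkovKernel κ] [MeasurableSpace.CountablyGenerated H]
    (L : Kernel Z H) [IsMarkovKernel L]
    (N : Kernel (H × S) Ω) [IsMarkovKernel N]
    (h : ∀ z s, κ (z, s) = (L z).bind (N.comap (fun h => (h, s)) measurable_prodMk_right))
    (ν : Measure Z) (μ : Measure S) [IsProbabilityMeasure ν] [IsProbabilityMeasure μ] :
    avgTV κ (ν.prod μ) ≤ avgTV L ν +
      ∫⁻ z, ∫⁻ h, avgTV (N.comap (fun s => (h, s)) measurable_prodMk_left) μ ∂(L z) ∂ν := by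
  have hκ := measurable_tvDist κ κ (S' := (Z × S) × (Z × S)) measurable_fst measurable_snd
  have hL := measurable_tvDist L L (S' := Z × Z) measurable_fst measurable_snd
  calc avgTV κ (ν.prod μ)
      = ∫⁻ z, ∫⁻ s, ∫⁻ z', ∫⁻ s', tvDist (κ (z, s)) (κ (z', s')) ∂μ ∂ν ∂μ ∂ν := by
        rw [avgTV, lintegral_prod _ hκ.lintegral_prod_right'.aemeasurable]
        refine lintegral_congr fun z => lintegral_congr fun s => ?_
        rw [lintegral_prod _ (by exact (hκ.comp measurable_prodMk_left).aemeasurable)]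
    _ ≤ ∫⁻ z, ∫⁻ s, ∫⁻ z', ∫⁻ s', (tvDist (L z) (L z') +
          ∫⁻ h, tvDist (N (h, s)) (N (h, s')) ∂(L z)) ∂μ ∂ν ∂μ ∂ν := by
        gcongr with z s z' s'
        rw [h, h]
        exact tvDist_bind_le_add _ _ _ _
    _ = ∫⁻ z, (∫⁻ z', tvDist (L z) (L z') ∂ν +
          ∫⁻ s, ∫⁻ s', ∫⁻ h, tvDist (N (h, s)) (N (h, s')) ∂(L z) ∂μ ∂μ) ∂ν := by
        refine lintegral_congr fun z => ?_
        have : Measurable fun z' => tvDist (L z) (L z') := hL.comp measurable_prodMk_left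
        simp_rw [lintegral_add_left measurable_const, lintegral_const, measure_univ, mul_one,
          lintegral_add_left this, lintegral_const, measure_univ, mul_one]
        rw [lintegral_add_left measurable_const]
        simp
    _ = avgTV L ν + ∫⁻ z, ∫⁻ s, ∫⁻ s', ∫⁻ h, tvDist (N (h, s)) (N (h, s')) ∂(L z) ∂μ ∂μ ∂ν := by
        rw [lintegral_add_left hL.lintegral_prod_right', avgTV]
    _ = _ := by
        congr 1
        refine lintegral_congr fun z => ?_
        simp only [avgTV, Kernel.comap_apply]
        have hN2 : Measurable fun p : H × S => ∫⁻ s', tvDist (N (p.1, p.2)) (N (p.1, s')) ∂μ :=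
          Measurable.lintegral_prod_right' (f := fun q : (H × S) × S =>
            tvDist (N (q.1.1, q.1.2)) (N (q.1.1, q.2)))
            (measurable_tvDist N N (by fun_prop) (by fun_prop))
        rw [lintegral_lintegral_swap (μ := L z) (ν := μ)
          (f := fun h s => ∫⁻ s', tvDist (N (h, s)) (N (h, s')) ∂μ) hN2.aemeasurable]
        refine lintegral_congr fun s => ?_
        rw [lintegral_lintegral_swap]
        exact (measurable_tvDist N N (f := fun q : S × H => (q.2, s))
          (g := fun q => (q.2, q.1)) (by fun_prop) (by fun_prop)).aemeasurable

end Kernels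

/-! ### Splitting i.i.d. samples. -/

section Samples

variable {X : Type*} [MeasurableSpace X]

instance (D : Measure (X × Bool)) [IsProbabilityMeasure D] (n : ℕ) :
    IsProbabilityMeasure (sampleLaw D n) := by
  unfold sampleLaw; infer_instance

/-- Split a sample into its first `a` and its last `b` examples. -/
def splitSample {E : Type*} (a b : ℕ) (S : Fin (a + b) → E) : (Fin a → E) × (Fin b → E) :=
  (fun i => S (Fin.castAdd b i), fun j => S (Fin.natAdd a j))

lemma measurePreserving_splitSample (D : Measure (X × Bool)) [IsProbabilityMeasure D] (a b : ℕ) :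
    MeasurePreserving (splitSample a b) (sampleLaw D (a + b))
      ((sampleLaw D a).prod (sampleLaw D b)) := by
  have h1 := (measurePreserving_piCongrLeft (fun _ : Fin (a + b) => D)
    (finSumFinEquiv (m := a) (n := b))).symm
  have h2 := measurePreserving_sumPiEquivProdPi (fun _ : Fin a ⊕ Fin b => D)
  exact h2.comp h1

lemma measurable_splitSample {E : Type*} [MeasurableSpace E] (a b : ℕ) :
    Measurable (splitSample a b : (Fin (a + b) → E) → _) := by
  unfold splitSample; fun_prop

lemma measurable_finCons {E Z : Type*} [MeasurableSpace E] [MeasurableSpace Z] {n : ℕ} {f : Z → E}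
    {g : Z → Fin n → E} (hf : Measurable f) (hg : Measurable g) :
    Measurable fun z => (Fin.cons (f z) (g z) : Fin (n + 1) → E) := by
  refine measurable_pi_lambda _ fun i => ?_
  refine Fin.cases ?_ (fun j => ?_) i
  · simpa using hf
  · simpa using (measurable_pi_iff.1 hg) j

lemma measurable_finSnoc {E Z : Type*} [MeasurableSpace E] [MeasurableSpace Z] {n : ℕ} {f : Z → E}
    {g : Z → Fin n → E} (hf : Measurable f) (hg : Measurable g) :
    Measurable fun z => (Fin.snoc (g z) (f z) : Fin (n + 1) → E) := by
  refine measurable_pi_lambda _ fun i => ?_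
  refine Fin.lastCases ?_ (fun j => ?_) i
  · simpa using hf
  · simpa using (measurable_pi_iff.1 hg) j

lemma measurable_finTail {E : Type*} [MeasurableSpace E] {n : ℕ} :
    Measurable (Fin.tail : (Fin (n + 1) → E) → Fin n → E) :=
  measurable_pi_lambda _ fun i => measurable_pi_apply i.succ

lemma lintegral_sampleLaw_succ (D : Measure (X × Bool)) [IsProbabilityMeasure D] (n : ℕ)
    {F : (Fin (n + 1) → X × Bool) → ℝ≥0∞} (hF : Measurable F) :
    ∫⁻ z, F z ∂(sampleLaw D (n + 1)) =
      ∫⁻ e, ∫⁻ z, F (Fin.cons e z) ∂(sampleLaw D n) ∂D := by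
  have h := (measurePreserving_piFinSuccAbove (fun _ : Fin (n + 1) => D) 0).symm
  have hF' : Measurable fun p : (X × Bool) × (Fin n → X × Bool) => F (Fin.cons p.1 p.2) :=
    hF.comp (measurable_finCons measurable_fst measurable_snd)
  calc ∫⁻ z, F z ∂(sampleLaw D (n + 1))
      = ∫⁻ p, F (Fin.cons p.1 p.2) ∂(D.prod (sampleLaw D n)) := by
        rw [sampleLaw, ← h.lintegral_comp hF]
        simp only [MeasurableEquiv.piFinSuccAbove_symm_apply, Fin.insertNthEquiv_zero]
        rfl
    _ = _ := lintegral_prod _ hF'.aemeasurable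

end Samples

/-! ### Rejection sampling. -/

section RejectionSampling

variable {X Θ : Type*} [MeasurableSpace X] [MeasurableSpace Θ]

/-- Rejection sampling: each of `M` examples `e` is accepted with probability `u (θ, e)`; the output
consists of the first `n` accepted examples, filled up with `e₀` if there are fewer. -/
noncomputable def rejectionKernel (u : Θ × (X × Bool) → ℝ≥0∞) (hu : Measurable u) (e₀ : X × Bool) :
    ∀ M n : ℕ, Kernel (Θ × (Fin M → X × Bool)) (Fin n → X × Bool)
  | 0, _ => Kernel.const _ (Measure.dirac fun _ => e₀)
  | _ + 1, 0 => Kernel.const _ (Measure.dirac fun _ => e₀)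
  | M + 1, n + 1 =>
    mixKernel (fun p => u (p.1, p.2 0)) (by fun_prop)
      (bindKernel ((rejectionKernel u hu e₀ M n).comap (fun p => (p.1, Fin.tail p.2))
          (measurable_fst.prodMk (measurable_finTail.comp measurable_snd)))
        (Kernel.deterministic (fun q => Fin.cons (q.2.2 0) q.1)
          (measurable_finCons (by fun_prop) (by fun_prop))))
      ((rejectionKernel u hu e₀ M (n + 1)).comap (fun p => (p.1, Fin.tail p.2))
          (measurable_fst.prodMk (measurable_finTail.comp measurable_snd)))

lemma isMarkovKernel_rejectionKernel {u : Θ × (X × Bool) → ℝ≥0∞} (hu : Measurable u)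
    (hu1 : ∀ p, u p ≤ 1) (e₀ : X × Bool) :
    ∀ M n : ℕ, IsMarkovKernel (rejectionKernel u hu e₀ M n)
  | 0, _ => by rw [rejectionKernel]; infer_instance
  | _ + 1, 0 => by rw [rejectionKernel]; infer_instance
  | M + 1, n + 1 => by
    have h1 := isMarkovKernel_rejectionKernel hu hu1 e₀ M n
    have h2 := isMarkovKernel_rejectionKernel hu hu1 e₀ M (n + 1)
    rw [rejectionKernel]
    exact isMarkovKernel_mixKernel _ (fun _ => hu1 _) _ _

/-- Up to the probability of seeing too few accepted examples, the output of rejection sampling is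
dominated by an independent sample from the reweighted distribution. -/
lemma lintegral_rejectionKernel_le {u : Θ × (X × Bool) → ℝ≥0∞} (hu : Measurable u)
    (hu1 : ∀ p, u p ≤ 1) (e₀ : X × Bool) (θ : Θ) (D D' : Measure (X × Bool))
    [IsProbabilityMeasure D] [IsProbabilityMeasure D'] {p q : ℝ≥0∞}
    (hD' : D.withDensity (fun e => u (θ, e)) = p • D')
    (hq : ∫⁻ e, (1 - u (θ, e)) ∂D = q) :
    ∀ (M n : ℕ) (g : (Fin n → X × Bool) → ℝ≥0∞), Measurable g → (∀ s, g s ≤ 1) →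
      ∫⁻ z, ∫⁻ s, g s ∂(rejectionKernel u hu e₀ M n (θ, z)) ∂(sampleLaw D M) ≤
        ∫⁻ s, g s ∂(sampleLaw D' n) + 2 ^ n * (p / 2 + q) ^ M
  -- With no trial left the output is unrelated to `D'`; the failure term `2 ^ n ≥ 1` pays for it.
  | 0, n, g, hg, hg1 => by
    have := isMarkovKernel_rejectionKernel hu hu1 e₀ 0 n
    calc _ ≤ ∫⁻ z, ∫⁻ s, 1 ∂(rejectionKernel u hu e₀ 0 n (θ, z)) ∂(sampleLaw D 0) := by
          gcongr; exact hg1 _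
      _ = 1 := by simp
      _ ≤ 2 ^ n * (p / 2 + q) ^ 0 := by simpa using one_le_pow₀ (by norm_num)
      _ ≤ _ := le_add_self
  | M + 1, 0, g, hg, hg1 => by
    have : ∀ s, g s = g fun _ => e₀ := fun s => congrArg g (Subsingleton.elim _ _)
    rw [lintegral_congr this]
    simp [rejectionKernel, lintegral_dirac' _ hg]
  | M + 1, n + 1, g, hg, hg1 => by
    have hw : Measurable fun e => u (θ, e) := by fun_prop
    have hpq : p + q = 1 := by
      have h1 : ∫⁻ e, u (θ, e) ∂D = p := by
        have := congrArg (fun μ => μ Set.univ) hD'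
        simpa using this
      rw [← h1, ← hq, ← lintegral_add_left hw]
      simp [add_tsub_cancel_of_le (hu1 _)]
    have := isMarkovKernel_rejectionKernel hu hu1 e₀ M n
    have := isMarkovKernel_rejectionKernel hu hu1 e₀ M (n + 1)
    have := isMarkovKernel_rejectionKernel hu hu1 e₀ (M + 1) (n + 1)
    have hcons : ∀ e, Measurable fun s : Fin n → X × Bool => g (Fin.cons e s) := fun e =>
      hg.comp (measurable_finCons measurable_const measurable_id)
    have hG : Measurable fun e => ∫⁻ s, g (Fin.cons e s) ∂(sampleLaw D' n) :=
      Measurable.lintegral_prod_right' (f := fun p : (X × Bool) × (Fin n → X × Bool) =>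
        g (Fin.cons p.1 p.2)) (hg.comp (measurable_finCons measurable_fst measurable_snd))
    have hm1 : ∀ e, Measurable fun z => ∫⁻ s, g (Fin.cons e s) ∂(rejectionKernel u hu e₀ M n (θ, z)) :=
      fun e => (hcons e).lintegral_kernel.comp measurable_prodMk_left
    have hm2 : Measurable fun z => ∫⁻ s, g s ∂(rejectionKernel u hu e₀ M (n + 1) (θ, z)) :=
      hg.lintegral_kernel.comp measurable_prodMk_left
    have hI : ∫⁻ s, g s ∂(sampleLaw D' (n + 1)) =
        ∫⁻ e, ∫⁻ s, g (Fin.cons e s) ∂(sampleLaw D' n) ∂D' := lintegral_sampleLaw_succ D' n hg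
    have step : ∀ e z, ∫⁻ s, g s ∂(rejectionKernel u hu e₀ (M + 1) (n + 1) (θ, Fin.cons e z)) =
        u (θ, e) * ∫⁻ s, g (Fin.cons e s) ∂(rejectionKernel u hu e₀ M n (θ, z)) +
          (1 - u (θ, e)) * ∫⁻ s, g s ∂(rejectionKernel u hu e₀ M (n + 1) (θ, z)) := by
      intro e z
      rw [rejectionKernel, mixKernel_apply, lintegral_add_measure, lintegral_smul_measure,
        lintegral_smul_measure, lintegral_bindKernel _ _ _ hg]
      simp [Kernel.comap_apply, Kernel.lintegral_deterministic' _ hg]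
    have hm3 : Measurable fun z =>
        ∫⁻ s, g s ∂(rejectionKernel u hu e₀ (M + 1) (n + 1) (θ, z)) :=
      hg.lintegral_kernel.comp measurable_prodMk_left
    rw [lintegral_sampleLaw_succ D M hm3]
    simp_rw [step]
    set I := ∫⁻ s, g s ∂(sampleLaw D' (n + 1))
    set c := (p / 2 + q) ^ M
    calc _ = ∫⁻ e, (u (θ, e) * ∫⁻ z, ∫⁻ s, g (Fin.cons e s) ∂(rejectionKernel u hu e₀ M n (θ, z))
              ∂(sampleLaw D M) + (1 - u (θ, e)) *
              ∫⁻ z, ∫⁻ s, g s ∂(rejectionKernel u hu e₀ M (n + 1) (θ, z)) ∂(sampleLaw D M)) ∂D := by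
          refine lintegral_congr fun e => ?_
          rw [lintegral_add_left ((hm1 e).const_mul _), lintegral_const_mul _ (hm1 e),
            lintegral_const_mul _ hm2]
      _ ≤ ∫⁻ e, (u (θ, e) * (∫⁻ s, g (Fin.cons e s) ∂(sampleLaw D' n) + 2 ^ n * c) +
              (1 - u (θ, e)) * (I + 2 ^ (n + 1) * c)) ∂D := by
          gcongr with e
          · exact lintegral_rejectionKernel_le hu hu1 e₀ θ D D' hD' hq M n _ (hcons e)
              fun _ => hg1 _
          · exact lintegral_rejectionKernel_le hu hu1 e₀ θ D D' hD' hq M (n + 1) g hg hg1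
      _ = p * I + p * (2 ^ n * c) + q * (I + 2 ^ (n + 1) * c) := by
          rw [lintegral_add_right _ (by fun_prop), lintegral_mul_const _ (by fun_prop), hq]
          congr 1
          have := lintegral_withDensity_eq_lintegral_mul D hw (hG.add_const (2 ^ n * c))
          simp only [Pi.mul_apply] at this
          rw [← this, hD', lintegral_smul_measure, lintegral_add_right _ measurable_const, ← hI]
          simp [mul_add]
      -- Acceptance lowers the number of missing examples and so halves the failure term, rejection
      -- keeps it: each trial multiplies it by `p / 2 + q`. This is the Chernoff bound with the
      -- moment of `2 ^ (-accepted)`.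
      _ = (p + q) * I + 2 ^ (n + 1) * c * (p / 2 + q) := by
          have : p = 2 * (p / 2) := (ENNReal.mul_div_cancel (by norm_num) (by norm_num)).symm
          generalize p / 2 = r at *
          subst this
          ring
      _ = _ := by rw [hpq, one_mul, pow_succ (p / 2 + q) M, mul_assoc]

end RejectionSampling

/-! ### A stopping probability with small relative variation. -/

section StoppingProbability

/-- A stopping probability that is `1` up to `a`, decays exponentially at rate `K` and vanishes once
the exponential reaches the level `s`. -/
noncomputable def stopProb (s K a x : ℝ) : ℝ :=
  max s (min (1 + s) ((1 + s) * Real.exp (-K * (x - a)))) - s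

variable {s K a : ℝ}

lemma stopProb_nonneg (x : ℝ) : 0 ≤ stopProb s K a x := sub_nonneg.2 (le_max_left _ _)

lemma stopProb_le_one (x : ℝ) : stopProb s K a x ≤ 1 := by
  have : max s (min (1 + s) ((1 + s) * Real.exp (-K * (x - a)))) ≤ 1 + s :=
    max_le (by linarith) (min_le_left _ _)
  unfold stopProb; linarith

lemma continuous_stopProb : Continuous (stopProb s K a) := by
  unfold stopProb; fun_prop

lemma stopProb_eq_one (hs : 0 ≤ s) (hK : 0 ≤ K) {x : ℝ} (hx : x ≤ a) : stopProb s K a x = 1 := by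
  have h1 : 1 ≤ Real.exp (-K * (x - a)) := Real.one_le_exp (by nlinarith)
  have h2 : 1 + s ≤ (1 + s) * Real.exp (-K * (x - a)) := by nlinarith
  rw [stopProb, min_eq_left h2, max_eq_right (by linarith)]
  ring

lemma stopProb_eq_zero (hs : 0 < s) {x : ℝ} (hx : Real.log ((1 + s) / s) ≤ K * (x - a)) :
    stopProb s K a x = 0 := by
  have h : (1 + s) * Real.exp (-K * (x - a)) ≤ s := by
    calc (1 + s) * Real.exp (-K * (x - a)) ≤ (1 + s) * Real.exp (-Real.log ((1 + s) / s)) := by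
          gcongr; linarith
      _ = s := by
          rw [Real.exp_neg, Real.exp_log (by positivity)]
          field_simp
  rw [stopProb, max_eq_left ((min_le_right _ _).trans h), sub_self]

/-- After adding `s`, what remains is an exponential of rate `K` truncated to `[s, 1 + s]`, whose
logarithm is `K`-Lipschitz. -/
lemma stopProb_add_le (hs : 0 ≤ s) (hK : 0 ≤ K) (x y : ℝ) :
    stopProb s K a x + s ≤ Real.exp (K * |x - y|) * (stopProb s K a y + s) := by
  have h1 : 1 ≤ Real.exp (K * |x - y|) := Real.one_le_exp (by positivity)
  have h2 : Real.exp (-K * (x - a)) ≤ Real.exp (K * |x - y|) * Real.exp (-K * (y - a)) := by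
    rw [← Real.exp_add]
    gcongr
    nlinarith [neg_abs_le (x - y)]
  simp only [stopProb, sub_add_cancel]
  rw [mul_max_of_nonneg _ _ (by positivity), mul_min_of_nonneg _ _ (by positivity)]
  refine max_le_max (by nlinarith) (min_le_min (by nlinarith) ?_)
  nlinarith

/-- The variation is relative to the stopping probability itself, up to the floor `s`. An absolute
Lipschitz bound would have to be paid in full in every round. -/
lemma abs_stopProb_sub_le (hs : 0 ≤ s) (hK : 0 ≤ K) (x y : ℝ) :
    |stopProb s K a x - stopProb s K a y| ≤
      (Real.exp (K * |x - y|) - 1) * (stopProb s K a y + s) := by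
  have h1 : 1 ≤ Real.exp (K * |x - y|) := Real.one_le_exp (by positivity)
  have h2 := stopProb_add_le (a := a) hs hK x y
  have h3 := stopProb_add_le (a := a) hs hK y x
  rw [abs_sub_comm y x] at h3
  have hx := stopProb_nonneg (s := s) (K := K) (a := a) x
  have hy := stopProb_nonneg (s := s) (K := K) (a := a) y
  rw [abs_le]
  constructor <;> nlinarith [mul_nonneg (sub_nonneg.2 h1) (sub_nonneg.2 h1)]

end StoppingProbability

/-! ### Concentration of empirical means. -/

section EmpiricalMean

variable {X : Type*} [MeasurableSpace X]

/-- Average of `w` over a sample. -/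
noncomputable def empMean {E : Type*} {M : ℕ} (w : E → ℝ) (z : Fin M → E) : ℝ := (∑ i, w (z i)) / M

lemma empMean_mem_Icc {E : Type*} {M : ℕ} {w : E → ℝ} (hw : ∀ e, w e ∈ Set.Icc (0 : ℝ) 1)
    (z : Fin M → E) : empMean w z ∈ Set.Icc (0 : ℝ) 1 := by
  refine ⟨div_nonneg (Finset.sum_nonneg fun i _ => (hw _).1) M.cast_nonneg, ?_⟩
  refine div_le_one_of_le₀ ?_ M.cast_nonneg
  simpa using Finset.sum_le_card_nsmul Finset.univ (fun i => w (z i)) 1 fun i _ => (hw _).2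

lemma measurable_empMean {E : Type*} [MeasurableSpace E] {M : ℕ} {w : E → ℝ} (hw : Measurable w) :
    Measurable (empMean w : (Fin M → E) → ℝ) := by
  unfold empMean; fun_prop

variable {D : Measure (X × Bool)} [IsProbabilityMeasure D] {w : X × Bool → ℝ} {M : ℕ}

/-- By Hoeffding's lemma each summand has variance proxy `1 / 4`; averaging `M` independent ones
divides it by `M`. -/
lemma hasSubgaussianMGF_empMean (hw : Measurable w) (hw1 : ∀ e, w e ∈ Set.Icc (0 : ℝ) 1)
    (hM : 0 < M) :
    HasSubgaussianMGF (fun z : Fin M → X × Bool => empMean w z - ∫ e, w e ∂D) (1 / (4 * M))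
      (sampleLaw D M) where
  integrable_exp_mul t := by
    refine integrable_exp_mul_of_mem_Icc (a := 0 - ∫ e, w e ∂D) (b := 1 - ∫ e, w e ∂D)
      ((measurable_empMean hw).sub_const _).aemeasurable (Filter.Eventually.of_forall fun z => ?_)
    have := empMean_mem_Icc hw1 z
    exact ⟨by linarith [this.1], by linarith [this.2]⟩
  mgf_le t := by
    have hM' : (M : ℝ) ≠ 0 := by positivity
    have h := (hasSubgaussianMGF_of_mem_Icc (μ := D) (X := w) hw.aemeasurable
      (Filter.Eventually.of_forall hw1)).mgf_le (t / M)
    have hprod : ∀ z : Fin M → X × Bool, Real.exp (t * (empMean w z - ∫ e, w e ∂D)) =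
        ∏ i, Real.exp (t / M * (w (z i) - ∫ e, w e ∂D)) := by
      intro z
      rw [← Real.exp_sum, ← Finset.mul_sum, Finset.sum_sub_distrib]
      congr 1
      simp only [empMean, Finset.sum_const, Finset.card_univ, Fintype.card_fin, nsmul_eq_mul]
      field_simp
    simp only [mgf, hprod, sampleLaw]
    rw [integral_fintype_prod_eq_pow (𝕜 := ℝ)
      (fun e => Real.exp (t / M * (w e - ∫ e, w e ∂D))), Fintype.card_fin]
    calc _ ≤ (Real.exp (((‖(1 : ℝ) - 0‖₊ / 2) ^ 2 : ℝ≥0) * (t / M) ^ 2 / 2)) ^ M := by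
          refine pow_le_pow_left₀ (integral_nonneg fun e => ?_) h M
          exact (Real.exp_pos _).le
      _ = _ := by
          rw [← Real.exp_nat_mul]
          congr 1
          push_cast
          simp
          field_simp
          norm_num
          ring

lemma measureReal_empMean_ge (hw : Measurable w) (hw1 : ∀ e, w e ∈ Set.Icc (0 : ℝ) 1)
    (hM : 0 < M) {τ : ℝ} (hτ : 0 ≤ τ) :
    (sampleLaw D M).real {z | τ ≤ empMean w z - ∫ e, w e ∂D} ≤ Real.exp (-2 * M * τ ^ 2) := by
  refine ((hasSubgaussianMGF_empMean hw hw1 hM).measure_ge_le hτ).trans_eq ?_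
  congr 1
  push_cast
  field_simp
  ring

lemma measureReal_empMean_le (hw : Measurable w) (hw1 : ∀ e, w e ∈ Set.Icc (0 : ℝ) 1)
    (hM : 0 < M) {τ : ℝ} (hτ : 0 ≤ τ) :
    (sampleLaw D M).real {z | τ ≤ ∫ e, w e ∂D - empMean w z} ≤ Real.exp (-2 * M * τ ^ 2) := by
  have h := (hasSubgaussianMGF_empMean (D := D) hw hw1 hM).neg.measure_ge_le hτ
  simp only [Pi.neg_apply, neg_sub] at h
  refine h.trans_eq ?_
  congr 1
  push_cast
  field_simp
  ring

/-- Convexity of `exp` between `0` and `L * |u|` gains the factor `1 / L`; the two one-sided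
exponentials replace `exp (L * |u|)` and have computable moments. -/
lemma exp_abs_sub_one_le {L : ℝ} (hL : 1 ≤ L) (u : ℝ) :
    Real.exp |u| - 1 ≤ (Real.exp (L * u) + Real.exp (-L * u) - 1) / L := by
  have hL0 : 0 < L := by linarith
  have hexp := convexOn_exp.2
  have hconv := hexp (Set.mem_univ (L * |u|)) (Set.mem_univ (0 : ℝ))
    (show 0 ≤ 1 / L by positivity) (sub_nonneg.2 ((div_le_one hL0).2 hL)) (by ring)
  simp only [smul_eq_mul, mul_zero, add_zero, Real.exp_zero, mul_one] at hconv
  rw [show 1 / L * (L * |u|) = |u| by field_simp] at hconv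
  have h2 : Real.exp (L * |u|) ≤ Real.exp (L * u) + Real.exp (-L * u) := by
    rcases abs_cases u with ⟨h, _⟩ | ⟨h, _⟩ <;> rw [h]
    · linarith [Real.exp_pos (-L * u)]
    · rw [show L * -u = -L * u by ring]; linarith [Real.exp_pos (L * u)]
  rw [le_div_iff₀ hL0]
  have h3 : Real.exp |u| * L ≤ Real.exp (L * |u|) + (L - 1) := by
    calc Real.exp |u| * L ≤ (1 / L * Real.exp (L * |u|) + (1 - 1 / L)) * L := by gcongr
      _ = _ := by field_simp
  nlinarith

lemma integrable_of_measurable_of_mem_Icc {Ω : Type*} [MeasurableSpace Ω] {μ : Measure Ω}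
    [IsFiniteMeasure μ] {f : Ω → ℝ} (hf : Measurable f) {a b : ℝ} (h : ∀ ω, f ω ∈ Set.Icc a b) :
    Integrable f μ :=
  Integrable.of_mem_Icc a b hf.aemeasurable (Filter.Eventually.of_forall h)

lemma integrable_exp_abs_empMean (hw : Measurable w) (hw1 : ∀ e, w e ∈ Set.Icc (0 : ℝ) 1)
    (K p : ℝ) :
    Integrable (fun z : Fin M → X × Bool => Real.exp (K * |empMean w z - p|)) (sampleLaw D M) := by
  have hm := measurable_empMean (M := M) hw
  refine integrable_of_measurable_of_mem_Icc (by fun_prop) (a := 0)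
    (b := Real.exp (|K| * (1 + |p|))) fun z => ⟨Real.exp_nonneg _, ?_⟩
  have h := empMean_mem_Icc hw1 z
  gcongr
  · exact le_abs_self K
  · refine (abs_sub _ _).trans ?_
    gcongr
    rw [abs_of_nonneg h.1]; exact h.2

/-- Deviations have order at most `M ^ (-1/2) ≤ 1 / (L * K)`, so the exponent has order `1 / L`. -/
lemma integral_exp_abs_empMean_le (hw : Measurable w) (hw1 : ∀ e, w e ∈ Set.Icc (0 : ℝ) 1)
    (hM : 0 < M) {K L : ℝ} (hK : 0 ≤ K) (hL : 1 ≤ L) (hKL : L ^ 2 * K ^ 2 ≤ M) :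
    ∫ z, (Real.exp (K * |empMean w z - ∫ e, w e ∂D|) - 1) ∂(sampleLaw D M) ≤ 2 / L := by
  set p := ∫ e, w e ∂D
  have hsub := hasSubgaussianMGF_empMean (D := D) hw hw1 hM
  have hM' : (0 : ℝ) < M := by positivity
  -- The moment is at most `exp (t² / (8M))`, hence at most `exp (1 / 8)`. The constant `2` of the
  -- claim is `3 / 2 + 3 / 2 - 1`.
  have hbd : ∀ t : ℝ, t ^ 2 = L ^ 2 * K ^ 2 →
      ∫ z, Real.exp (t * (empMean w z - p)) ∂(sampleLaw D M) ≤ 3 / 2 := by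
    intro t ht
    refine (hsub.mgf_le t).trans ?_
    rw [ht]
    calc Real.exp (((1 / (4 * M) : ℝ≥0) : ℝ) * (L ^ 2 * K ^ 2) / 2) ≤ Real.exp (1 / 8) := by
          refine Real.exp_le_exp.2 ?_
          push_cast
          calc 1 / (4 * (M : ℝ)) * (L ^ 2 * K ^ 2) / 2 ≤ 1 / (4 * (M : ℝ)) * M / 2 := by gcongr
            _ = 1 / 8 := by field_simp; norm_num
      _ ≤ 3 / 2 := by
          have := Real.exp_bound_div_one_sub_of_interval' (x := 1 / 8) (by norm_num) (by norm_num)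
          exact this.le.trans (by norm_num)
  have hi1 := hsub.integrable_exp_mul (L * K)
  have hi2 := hsub.integrable_exp_mul (-L * K)
  have hint : Integrable (fun z : Fin M → X × Bool => (Real.exp (L * K * (empMean w z - p)) +
      Real.exp (-L * K * (empMean w z - p)) - 1) / L) (sampleLaw D M) :=
    ((hi1.add hi2).sub (integrable_const 1)).div_const L
  calc _ ≤ ∫ z, (Real.exp (L * K * (empMean w z - p)) +
            Real.exp (-L * K * (empMean w z - p)) - 1) / L ∂(sampleLaw D M) := by
        refine integral_mono ((integrable_exp_abs_empMean hw hw1 K p).sub (integrable_const 1))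
          hint fun z => ?_
        have := exp_abs_sub_one_le hL (K * (empMean w z - p))
        rw [abs_mul, abs_of_nonneg hK] at this
        simpa only [mul_assoc, neg_mul] using this
    _ = (∫ z, Real.exp (L * K * (empMean w z - p)) ∂(sampleLaw D M) +
          ∫ z, Real.exp (-L * K * (empMean w z - p)) ∂(sampleLaw D M) - 1) / L := by
        have hi3 : Integrable (fun z : Fin M → X × Bool => Real.exp (L * K * (empMean w z - p)) +
            Real.exp (-L * K * (empMean w z - p))) (sampleLaw D M) := hi1.add hi2
        rw [integral_div, integral_sub hi3 (integrable_const 1), integral_add hi1 hi2]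
        simp [p]
    _ ≤ (3 / 2 + 3 / 2 - 1) / L := by
        gcongr
        · exact hbd _ (by ring)
        · exact hbd _ (by ring)
    _ = _ := by norm_num

end EmpiricalMean

/-! ### The randomised stopping test: correctness and stability. -/

section StoppingTest

variable {X : Type*} [MeasurableSpace X] {D : Measure (X × Bool)} [IsProbabilityMeasure D]
  {w : X × Bool → ℝ} {M : ℕ} {s ε : ℝ}

/-- The probability of stopping, given the average of `w` on a sample. It is `1` up to `ε / 2` and
`0` from `3 * ε / 4` on. -/
noncomputable def stopTest {E : Type*} {M : ℕ} (s ε : ℝ) (w : E → ℝ) (z : Fin M → E) : ℝ≥0∞ :=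
  ENNReal.ofReal (stopProb s (4 / ε * Real.log ((1 + s) / s)) (ε / 2) (empMean w z))

lemma stopTest_le_one {E : Type*} {M : ℕ} (w : E → ℝ) (z : Fin M → E) : stopTest s ε w z ≤ 1 :=
  ENNReal.ofReal_le_one.2 (stopProb_le_one _)

lemma measurable_stopTest (hw : Measurable w) :
    Measurable (stopTest s ε w : (Fin M → X × Bool) → ℝ≥0∞) :=
  (continuous_stopProb.measurable.comp (measurable_empMean hw)).ennreal_ofReal

/-- The test surely stops up to an empirical mean of `ε / 2`, so failing to stop requires a
deviation of `ε / 4`. -/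
lemma lintegral_one_sub_stopTest_le (hw : Measurable w) (hw1 : ∀ e, w e ∈ Set.Icc (0 : ℝ) 1)
    (hM : 0 < M) (hs : 0 < s) (hε : 0 < ε) (hp : ∫ e, w e ∂D ≤ ε / 4) :
    ∫⁻ z, (1 - stopTest s ε w z) ∂(sampleLaw D M) ≤
      ENNReal.ofReal (Real.exp (-M * ε ^ 2 / 8)) := by
  have hm := measurable_empMean (M := M) hw
  have hK : 0 ≤ 4 / ε * Real.log ((1 + s) / s) :=
    mul_nonneg (by positivity) (Real.log_nonneg ((one_le_div hs).2 (by linarith)))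
  set B : Set (Fin M → X × Bool) := {z | ε / 4 ≤ empMean w z - ∫ e, w e ∂D}
  have hB : MeasurableSet B := measurableSet_le measurable_const (hm.sub_const _)
  calc _ ≤ ∫⁻ z, B.indicator 1 z ∂(sampleLaw D M) := by
        gcongr with z
        by_cases hz : z ∈ B
        · simp [hz]
        · have : empMean w z ≤ ε / 2 := by
            have : ¬ (ε / 4 ≤ empMean w z - ∫ e, w e ∂D) := hz
            linarith
          simp [stopTest, stopProb_eq_one hs.le hK this]
    _ = ENNReal.ofReal ((sampleLaw D M).real B) := by
        rw [lintegral_indicator_one hB, ofReal_measureReal]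
    _ ≤ _ := by
        refine ENNReal.ofReal_le_ofReal
          ((measureReal_empMean_ge hw hw1 hM (by positivity)).trans_eq ?_)
        congr 1; ring

/-- The rate `4 / ε * log ((1 + s) / s)` brings the exponential from `1 + s` down to `s` over a
length `ε / 4`. Hence the test never stops from `3 * ε / 4` on, and stopping here requires a
deviation of at least `ε / 4`. -/
lemma lintegral_stopTest_le (hw : Measurable w) (hw1 : ∀ e, w e ∈ Set.Icc (0 : ℝ) 1)
    (hM : 0 < M) (hs : 0 < s) (hε : 0 < ε) (hp : ε ≤ ∫ e, w e ∂D) :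
    ∫⁻ z, stopTest s ε w z ∂(sampleLaw D M) ≤ ENNReal.ofReal (Real.exp (-M * ε ^ 2 / 8)) := by
  have hm := measurable_empMean (M := M) hw
  have hl : 0 ≤ Real.log ((1 + s) / s) := Real.log_nonneg ((one_le_div hs).2 (by linarith))
  set B : Set (Fin M → X × Bool) := {z | ε / 4 ≤ ∫ e, w e ∂D - empMean w z}
  have hB : MeasurableSet B := measurableSet_le measurable_const (measurable_const.sub hm)
  calc _ ≤ ∫⁻ z, B.indicator 1 z ∂(sampleLaw D M) := by
        gcongr with z
        by_cases hz : z ∈ B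
        · simpa [hz] using stopTest_le_one w z
        · have : ε / 4 ≤ empMean w z - ε / 2 := by
            have : ¬ (ε / 4 ≤ ∫ e, w e ∂D - empMean w z) := hz
            linarith
          have h : Real.log ((1 + s) / s) ≤
              4 / ε * Real.log ((1 + s) / s) * (empMean w z - ε / 2) := by
            calc Real.log ((1 + s) / s) = 4 / ε * Real.log ((1 + s) / s) * (ε / 4) := by field_simp
              _ ≤ _ := by gcongr
          simp [stopTest, stopProb_eq_zero hs h]
    _ = ENNReal.ofReal ((sampleLaw D M).real B) := by
        rw [lintegral_indicator_one hB, ofReal_measureReal]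
    _ ≤ _ := by
        refine ENNReal.ofReal_le_ofReal
          ((measureReal_empMean_le hw hw1 hM (by positivity)).trans_eq ?_)
        congr 1; ring

/-- The decisions of the test on two independent samples differ by little compared with the
probability of stopping. -/
lemma lintegral_stopTest_sub_le (hw : Measurable w) (hw1 : ∀ e, w e ∈ Set.Icc (0 : ℝ) 1)
    (hM : 0 < M) (hs : 0 < s) (hε : 0 < ε) {L : ℝ} (hL : 4 ≤ L)
    (hLM : L ^ 2 * (4 / ε * Real.log ((1 + s) / s)) ^ 2 ≤ M) :
    ∫⁻ z, ∫⁻ z', ((stopTest s ε w z - stopTest s ε w z') +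
        (stopTest s ε w z' - stopTest s ε w z)) ∂(sampleLaw D M) ∂(sampleLaw D M) ≤
      ENNReal.ofReal (8 / L) * (∫⁻ z, stopTest s ε w z ∂(sampleLaw D M) + ENNReal.ofReal s) := by
  have hm := measurable_empMean (M := M) hw
  set K := 4 / ε * Real.log ((1 + s) / s) with hKdef
  have hK : 0 ≤ K :=
    mul_nonneg (by positivity) (Real.log_nonneg ((one_le_div hs).2 (by linarith)))
  set p := ∫ e, w e ∂D with hp
  set f : ℝ → ℝ := stopProb s K (ε / 2) with hfdef
  have hfm : Measurable f := continuous_stopProb.measurable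
  have hf0 : ∀ x, 0 ≤ f x := stopProb_nonneg
  have hf1 : ∀ x, f x ≤ 1 := stopProb_le_one
  set η := ∫ z, (Real.exp (K * |empMean w z - p|) - 1) ∂(sampleLaw D M) with hη
  have hηL : η ≤ 2 / L := integral_exp_abs_empMean_le hw hw1 hM hK (by linarith) hLM
  have hη0 : 0 ≤ η := integral_nonneg fun z =>
    sub_nonneg.2 (Real.one_le_exp (mul_nonneg hK (abs_nonneg _)))
  have hfi : Integrable (fun z => f (empMean w z)) (sampleLaw D M) :=
    integrable_of_measurable_of_mem_Icc (hfm.comp hm) fun z => ⟨hf0 _, hf1 _⟩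
  have hgi : Integrable (fun z => |f (empMean w z) - f p|) (sampleLaw D M) :=
    (hfi.sub (integrable_const _)).abs
  have hdev : ∫ z, |f (empMean w z) - f p| ∂(sampleLaw D M) ≤ η * (f p + s) := by
    rw [hη, ← integral_mul_const]
    refine integral_mono hgi (((integrable_exp_abs_empMean hw hw1 K p).sub
      (integrable_const 1)).mul_const _) fun z => ?_
    exact abs_stopProb_sub_le hs.le hK _ _
  -- Deviations are measured from the value `f p` at the true mean. As `η ≤ 1 / 2`, this inequality
  -- can be solved for `f p + s ≤ 2 * (m + s)`, which brings in the actual probability `m` of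
  -- stopping.
  have hmean : f p ≤ ∫ z, f (empMean w z) ∂(sampleLaw D M) + η * (f p + s) := by
    have h1 : ∫ z, (f p - f (empMean w z)) ∂(sampleLaw D M) ≤
        ∫ z, |f (empMean w z) - f p| ∂(sampleLaw D M) :=
      integral_mono ((integrable_const _).sub hfi) hgi fun z => by
        simpa only [abs_sub_comm] using le_abs_self (f p - f (empMean w z))
    rw [integral_sub (integrable_const _) hfi] at h1
    simp only [integral_const, probReal_univ, smul_eq_mul, one_mul] at h1
    linarith
  have hηhalf : η ≤ 1 / 2 := hηL.trans (by rw [div_le_div_iff₀] <;> linarith)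
  set m := ∫ z, f (empMean w z) ∂(sampleLaw D M) with hmdef
  have hm0 : 0 ≤ m := integral_nonneg fun _ => hf0 _
  have hbound : 2 * (η * (f p + s)) ≤ 8 / L * (m + s) := by
    have h1 : f p + s ≤ 2 * (m + s) := by nlinarith [hf0 p]
    have h2 : η * (f p + s) ≤ 2 / L * (2 * (m + s)) :=
      mul_le_mul hηL h1 (by linarith [hf0 p]) (by positivity)
    calc 2 * (η * (f p + s)) ≤ 2 * (2 / L * (2 * (m + s))) := by linarith
      _ = _ := by ring
  have hgm : Measurable fun z : Fin M → X × Bool => ENNReal.ofReal |f (empMean w z) - f p| := by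
    have := hfm.comp hm
    simp only [Function.comp_def] at this
    fun_prop
  calc _ ≤ ∫⁻ z, ∫⁻ z', (ENNReal.ofReal |f (empMean w z) - f p| +
          ENNReal.ofReal |f (empMean w z') - f p|) ∂(sampleLaw D M) ∂(sampleLaw D M) := by
        refine lintegral_mono fun z => lintegral_mono fun z' => ?_
        simp only [stopTest, ← hKdef, ← hfdef]
        rw [← ENNReal.ofReal_sub _ (hf0 _), ← ENNReal.ofReal_sub _ (hf0 _),
          ← ENNReal.ofReal_add (abs_nonneg _) (abs_nonneg _)]
        have h := abs_sub_le (f (empMean w z)) (f p) (f (empMean w z'))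
        rw [abs_sub_comm (f p)] at h
        rcases le_total (f (empMean w z)) (f (empMean w z')) with h' | h'
        · rw [ENNReal.ofReal_of_nonpos (sub_nonpos.2 h'), zero_add]
          rw [abs_sub_comm (f (empMean w z)), abs_of_nonneg (sub_nonneg.2 h')] at h
          exact ENNReal.ofReal_le_ofReal h
        · rw [ENNReal.ofReal_of_nonpos (sub_nonpos.2 h'), add_zero]
          rw [abs_of_nonneg (sub_nonneg.2 h')] at h
          exact ENNReal.ofReal_le_ofReal h
    _ = 2 * ENNReal.ofReal (∫ z, |f (empMean w z) - f p| ∂(sampleLaw D M)) := by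
        rw [ofReal_integral_eq_lintegral_ofReal hgi (Filter.Eventually.of_forall fun _ => abs_nonneg _)]
        simp_rw [lintegral_add_left measurable_const, lintegral_const, measure_univ, mul_one]
        rw [lintegral_add_left hgm, lintegral_const, measure_univ, mul_one, two_mul]
    _ ≤ ENNReal.ofReal (8 / L * (m + s)) := by
        rw [← ENNReal.ofReal_ofNat 2, ← ENNReal.ofReal_mul (by norm_num)]
        exact ENNReal.ofReal_le_ofReal (by linarith)
    _ = _ := by
        rw [ENNReal.ofReal_mul (by positivity), ENNReal.ofReal_add hm0 hs.le, hmdef,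
          ofReal_integral_eq_lintegral_ofReal hfi (Filter.Eventually.of_forall fun _ => hf0 _)]
        rfl

end StoppingTest

/-! ### Weight and potential of a single example. -/

section Potential

/-- Weight of an example on which the correct votes exceed the wrong ones by `N`. -/
noncomputable def voteWeight (γ : ℝ) (N : ℤ) : ℝ := ((1 - γ) / (1 + γ)) ^ N.toNat

/-- Potential of an example on which the correct votes exceed the wrong ones by `N`. -/
noncomputable def votePotential (γ : ℝ) (N : ℤ) : ℝ :=
  (1 - γ ^ 2) / (2 * γ) * (1 - voteWeight γ N) - (1 - γ) * ((-N).toNat : ℝ)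

variable {γ : ℝ}

lemma voteWeight_mem_Icc (hγ : γ ∈ Set.Ioo (0 : ℝ) 1) (N : ℤ) :
    voteWeight γ N ∈ Set.Icc (0 : ℝ) 1 := by
  obtain ⟨h0, h1⟩ := hγ
  have h : 0 ≤ (1 - γ) / (1 + γ) := div_nonneg (by linarith) (by linarith)
  exact ⟨pow_nonneg h _, pow_le_one₀ h ((div_le_one (by linarith)).2 (by linarith))⟩

lemma voteWeight_of_nonpos {N : ℤ} (hN : N ≤ 0) : voteWeight γ N = 1 := by
  simp [voteWeight, Int.toNat_of_nonpos hN]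

lemma votePotential_le (hγ : γ ∈ Set.Ioo (0 : ℝ) 1) (N : ℤ) :
    votePotential γ N ≤ (1 - γ ^ 2) / (2 * γ) := by
  have h := voteWeight_mem_Icc hγ N
  obtain ⟨h0, h1⟩ := hγ
  have hc : 0 ≤ (1 - γ ^ 2) / (2 * γ) := div_nonneg (by nlinarith) (by linarith)
  have : 0 ≤ (1 - γ) * ((-N).toNat : ℝ) := mul_nonneg (by linarith) (Nat.cast_nonneg _)
  unfold votePotential
  nlinarith [h.1]

lemma neg_le_votePotential (hγ : γ ∈ Set.Ioo (0 : ℝ) 1) {N : ℤ} {k : ℕ} (hN : -(k : ℤ) ≤ N) :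
    -(k : ℝ) ≤ votePotential γ N := by
  have h := voteWeight_mem_Icc hγ N
  obtain ⟨h0, h1⟩ := hγ
  have hc : 0 ≤ (1 - γ ^ 2) / (2 * γ) := div_nonneg (by nlinarith) (by linarith)
  have hk : ((-N).toNat : ℝ) ≤ k := by exact_mod_cast (by omega : (-N).toNat ≤ k)
  have h2 : (0 : ℝ) ≤ ((-N).toNat : ℝ) := Nat.cast_nonneg _
  unfold votePotential
  nlinarith [mul_nonneg hc (sub_nonneg.2 h.2)]

/-- The increment of the potential is at least weight times (vote minus `γ`). With `r = (1 - γ) / (1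
+ γ)` and `c = (1 - γ²) / (2γ)`, both `c * (1 - r) = 1 - γ` and `c * (1 / r - 1) = 1 + γ` hold, so
geometric weights give equality in both directions at positive margins. -/
lemma votePotential_add_one (hγ : γ ∈ Set.Ioo (0 : ℝ) 1) (N : ℤ) :
    votePotential γ N + voteWeight γ N * (1 - γ) ≤ votePotential γ (N + 1) := by
  obtain ⟨h0, h1⟩ := hγ
  rcases lt_or_ge N 0 with hN | hN
  · obtain ⟨n, rfl⟩ : ∃ n : ℕ, N = -(n + 1 : ℤ) := ⟨(-N - 1).toNat, by omega⟩
    rw [votePotential, votePotential, voteWeight_of_nonpos (by omega),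
      voteWeight_of_nonpos (by omega)]
    have e1 : (-(-((n : ℤ) + 1))).toNat = n + 1 := by omega
    have e2 : (-(-((n : ℤ) + 1) + 1)).toNat = n := by omega
    rw [e1, e2]
    push_cast
    linarith
  · lift N to ℕ using hN
    have e1 : (-(N : ℤ)).toNat = 0 := by omega
    have e2 : (-((N : ℤ) + 1)).toNat = 0 := by omega
    have e3 : ((N : ℤ) + 1).toNat = N + 1 := by omega
    simp only [votePotential, voteWeight, e1, e2, e3, Int.toNat_natCast, pow_succ]
    apply le_of_eq
    have : 1 + γ ≠ 0 := by linarith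
    generalize hR : ((1 - γ) / (1 + γ)) ^ N = R
    field_simp
    ring

/-- Equality for `N > 0`; for `N ≤ 0` the potential drops by only `1 - γ`, which leaves a slack of
`2 * γ`. -/
lemma votePotential_sub_one (hγ : γ ∈ Set.Ioo (0 : ℝ) 1) (N : ℤ) :
    votePotential γ N + voteWeight γ N * (-1 - γ) ≤ votePotential γ (N - 1) := by
  obtain ⟨h0, h1⟩ := hγ
  rcases le_or_gt N 0 with hN | hN
  · obtain ⟨n, rfl⟩ : ∃ n : ℕ, N = -(n : ℤ) := ⟨(-N).toNat, by omega⟩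
    rw [votePotential, votePotential, voteWeight_of_nonpos (by omega),
      voteWeight_of_nonpos (by omega)]
    have e1 : (-(-(n : ℤ))).toNat = n := by omega
    have e2 : (-(-(n : ℤ) - 1)).toNat = n + 1 := by omega
    rw [e1, e2]
    push_cast
    linarith
  · obtain ⟨n, rfl⟩ : ∃ n : ℕ, N = (n : ℤ) + 1 := ⟨(N - 1).toNat, by omega⟩
    have e1 : (-((n : ℤ) + 1)).toNat = 0 := by omega
    have e2 : (-((n : ℤ) + 1 - 1)).toNat = 0 := by omega
    have e3 : ((n : ℤ) + 1).toNat = n + 1 := by omega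
    have e4 : ((n : ℤ) + 1 - 1).toNat = n := by omega
    simp only [votePotential, voteWeight, e1, e2, e3, e4, pow_succ]
    apply le_of_eq
    have : 1 + γ ≠ 0 := by linarith
    generalize hR : ((1 - γ) / (1 + γ)) ^ n = R
    field_simp
    ring

end Potential

/-! ### Margins, majority votes, reweighting and the average potential. -/

section Votes

variable {X : Type*} [MeasurableSpace X] {𝒞 : Set (X → Bool)} {k : ℕ} {γ : ℝ}

/-- `1` if `h` is correct on the example and `-1` if it is wrong. -/
def vote (h : 𝒞) (e : X × Bool) : ℤ := if (h : X → Bool) e.1 = e.2 then 1 else -1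

/-- Number of correct votes minus number of wrong votes. -/
def margin (h : Fin k → 𝒞) (e : X × Bool) : ℤ := ∑ i, vote (h i) e

lemma margin_snoc (h : Fin k → 𝒞) (g : 𝒞) (e : X × Bool) :
    margin (Fin.snoc h g : Fin (k + 1) → 𝒞) e = margin h e + vote g e := by
  simp [margin, Fin.sum_univ_castSucc]

lemma neg_le_margin (h : Fin k → 𝒞) (e : X × Bool) : -(k : ℤ) ≤ margin h e := by
  have : ∀ i ∈ Finset.univ, (-1 : ℤ) ≤ vote (h i) e := fun i _ => by unfold vote; split_ifs <;> simp
  simpa [margin] using Finset.card_nsmul_le_sum Finset.univ _ _ this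

/-- Majority vote. -/
def majority (h𝒞 : IsClassifierSpace 𝒞) (h : Fin k → 𝒞) : 𝒞 :=
  ⟨fun x => decide (0 < ∑ i, if (h i : X → Bool) x then (1 : ℤ) else -1),
    h𝒞.boolean_closed k (fun b => decide (0 < ∑ i, if b i then (1 : ℤ) else -1))
      (fun i => h i) fun i => (h i).2⟩

lemma margin_nonpos_of_majority_ne (h𝒞 : IsClassifierSpace 𝒞) (h : Fin k → 𝒞) {e : X × Bool}
    (he : (majority h𝒞 h : X → Bool) e.1 ≠ e.2) : margin h e ≤ 0 := by
  obtain ⟨x, y⟩ := e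
  cases y
  · have h1 : 0 < ∑ i, if (h i : X → Bool) x then (1 : ℤ) else -1 := by simpa [majority] using he
    have h2 : margin h (x, false) = -∑ i, if (h i : X → Bool) x then (1 : ℤ) else -1 := by
      rw [margin, ← Finset.sum_neg_distrib]
      refine Finset.sum_congr rfl fun i _ => ?_
      cases hx : (h i : X → Bool) x <;> simp [vote, hx]
    omega
  · have h1 : ¬ 0 < ∑ i, if (h i : X → Bool) x then (1 : ℤ) else -1 := by
      simpa [majority] using he
    simpa [margin, vote] using not_lt.1 h1

lemma measurable_majority (h𝒞 : IsClassifierSpace 𝒞) :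
    Measurable (majority h𝒞 : (Fin k → 𝒞) → 𝒞) := by
  refine Measurable.subtype_mk (measurable_pi_lambda _ fun x => ?_)
  have h1 : Measurable fun b : Fin k → Bool => decide (0 < ∑ i, if b i then (1 : ℤ) else -1) :=
    measurable_of_countable _
  have h2 : Measurable fun h : Fin k → 𝒞 => fun i => (h i : X → Bool) x :=
    measurable_pi_lambda _ fun i =>
      (measurable_pi_apply x).comp (measurable_subtype_coe.comp (measurable_pi_apply i))
  exact h1.comp h2

lemma measurableSet_ne_label (h𝒞 : IsClassifierSpace 𝒞) :
    MeasurableSet {p : 𝒞 × (X × Bool) | (p.1 : X → Bool) p.2.1 ≠ p.2.2} := by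
  have h1 : Measurable fun p : 𝒞 × (X × Bool) => (p.1 : X → Bool) p.2.1 :=
    h𝒞.measurable_eval.comp (measurable_fst.prodMk (measurable_fst.comp measurable_snd))
  exact (measurableSet_eq_fun h1 (measurable_snd.comp measurable_snd)).compl

lemma measurableSet_ne_label_right (h𝒞 : IsClassifierSpace 𝒞) (h : 𝒞) :
    MeasurableSet {e : X × Bool | (h : X → Bool) e.1 ≠ e.2} :=
  measurable_prodMk_left (x := h) (measurableSet_ne_label h𝒞)

lemma measurable_err (h𝒞 : IsClassifierSpace 𝒞) (D : Measure (X × Bool)) [SFinite D] :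
    Measurable fun h : 𝒞 => err D (h : X → Bool) :=
  (measurable_measure_prodMk_left (ν := D) (measurableSet_ne_label h𝒞)).ennreal_toReal

lemma measurable_vote (h𝒞 : IsClassifierSpace 𝒞) :
    Measurable fun p : 𝒞 × (X × Bool) => vote p.1 p.2 := by
  have : (fun p : 𝒞 × (X × Bool) => vote p.1 p.2) =
      fun p => if (p.1 : X → Bool) p.2.1 ≠ p.2.2 then -1 else 1 := by
    ext p; simp [vote]
  rw [this]
  exact Measurable.ite (measurableSet_ne_label h𝒞) measurable_const measurable_const

lemma measurable_margin (h𝒞 : IsClassifierSpace 𝒞) :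
    Measurable fun p : (Fin k → 𝒞) × (X × Bool) => margin p.1 p.2 := by
  refine Finset.measurable_sum _ fun i _ => ?_
  have h1 : Measurable fun p : (Fin k → 𝒞) × (X × Bool) => (p.1 i, p.2) := by fun_prop
  exact (measurable_vote h𝒞).comp h1

lemma measurable_margin_right (h𝒞 : IsClassifierSpace 𝒞) (h : Fin k → 𝒞) :
    Measurable (margin h) := (measurable_margin h𝒞).comp measurable_prodMk_left

/-- Weight of an example after the votes `h`. -/
noncomputable def exampleWeight (γ : ℝ) (h : Fin k → 𝒞) (e : X × Bool) : ℝ :=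
  voteWeight γ (margin h e)

/-- The average weight of the examples after the votes `h`. -/
noncomputable def density (γ : ℝ) (D : Measure (X × Bool)) (h : Fin k → 𝒞) : ℝ :=
  ∫ e, exampleWeight γ h e ∂D

lemma measurable_exampleWeight (h𝒞 : IsClassifierSpace 𝒞) :
    Measurable fun p : (Fin k → 𝒞) × (X × Bool) => exampleWeight γ p.1 p.2 :=
  (measurable_of_countable (voteWeight γ)).comp (measurable_margin h𝒞)

lemma measurable_exampleWeight_right (h𝒞 : IsClassifierSpace 𝒞) (h : Fin k → 𝒞) :
    Measurable (exampleWeight γ h) := (measurable_exampleWeight h𝒞).comp measurable_prodMk_left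

lemma exampleWeight_mem_Icc (hγ : γ ∈ Set.Ioo (0 : ℝ) 1) (h : Fin k → 𝒞) (e : X × Bool) :
    exampleWeight γ h e ∈ Set.Icc (0 : ℝ) 1 := voteWeight_mem_Icc hγ _

variable {D : Measure (X × Bool)} [IsProbabilityMeasure D]

lemma integrable_exampleWeight (h𝒞 : IsClassifierSpace 𝒞) (hγ : γ ∈ Set.Ioo (0 : ℝ) 1)
    (h : Fin k → 𝒞) : Integrable (exampleWeight γ h) D :=
  integrable_of_measurable_of_mem_Icc (measurable_exampleWeight_right h𝒞 h)
    (exampleWeight_mem_Icc hγ h)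

/-- An error of the majority forces a nonpositive margin, ties included, and there the weight is
exactly 1. So the indicator of an error is at most the weight. -/
lemma err_majority_le (h𝒞 : IsClassifierSpace 𝒞) (hγ : γ ∈ Set.Ioo (0 : ℝ) 1) (h : Fin k → 𝒞) :
    err D (majority h𝒞 h : X → Bool) ≤ density γ D h := by
  have hm := measurableSet_ne_label_right h𝒞 (majority h𝒞 h)
  rw [err, ← integral_indicator_one hm]
  refine integral_mono ((integrable_const 1).indicator hm) (integrable_exampleWeight h𝒞 hγ h)
    fun e => Set.indicator_le' (fun e he => ?_) (fun e _ => (exampleWeight_mem_Icc hγ h e).1) e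
  simp [exampleWeight, voteWeight_of_nonpos (margin_nonpos_of_majority_ne h𝒞 h he)]

/-- The distribution that boosting presents to the weak learner after the votes `h`. -/
noncomputable def reweighted (γ : ℝ) (D : Measure (X × Bool)) (h : Fin k → 𝒞) :
    Measure (X × Bool) :=
  (ENNReal.ofReal (density γ D h))⁻¹ •
    D.withDensity fun e => ENNReal.ofReal (exampleWeight γ h e)

lemma lintegral_exampleWeight (h𝒞 : IsClassifierSpace 𝒞) (hγ : γ ∈ Set.Ioo (0 : ℝ) 1)
    (h : Fin k → 𝒞) :
    ∫⁻ e, ENNReal.ofReal (exampleWeight γ h e) ∂D = ENNReal.ofReal (density γ D h) :=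
  (ofReal_integral_eq_lintegral_ofReal (integrable_exampleWeight h𝒞 hγ h)
    (Filter.Eventually.of_forall fun e => (exampleWeight_mem_Icc hγ h e).1)).symm

lemma lintegral_one_sub_exampleWeight (h𝒞 : IsClassifierSpace 𝒞) (hγ : γ ∈ Set.Ioo (0 : ℝ) 1)
    (h : Fin k → 𝒞) :
    ∫⁻ e, (1 - ENNReal.ofReal (exampleWeight γ h e)) ∂D =
      ENNReal.ofReal (1 - density γ D h) := by
  have hi := integrable_exampleWeight (D := D) h𝒞 hγ h
  have h1 : ∀ e, 0 ≤ 1 - exampleWeight γ h e := fun e =>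
    sub_nonneg.2 (exampleWeight_mem_Icc hγ h e).2
  calc _ = ∫⁻ e, ENNReal.ofReal (1 - exampleWeight γ h e) ∂D := by
        refine lintegral_congr fun e => ?_
        rw [ENNReal.ofReal_sub _ (exampleWeight_mem_Icc hγ h e).1, ENNReal.ofReal_one]
    _ = ENNReal.ofReal (∫ e, (1 - exampleWeight γ h e) ∂D) :=
        (ofReal_integral_eq_lintegral_ofReal ((integrable_const 1).sub hi)
          (Filter.Eventually.of_forall h1)).symm
    _ = _ := by rw [integral_sub (integrable_const 1) hi]; simp [density]

lemma withDensity_eq_smul_reweighted {h : Fin k → 𝒞} (hp : 0 < density γ D h) :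
    D.withDensity (fun e => ENNReal.ofReal (exampleWeight γ h e)) =
      ENNReal.ofReal (density γ D h) • reweighted γ D h := by
  rw [reweighted, smul_smul, ENNReal.mul_inv_cancel (by simpa using hp) ENNReal.ofReal_ne_top,
    one_smul]

lemma isReweighting_reweighted (h𝒞 : IsClassifierSpace 𝒞) (hγ : γ ∈ Set.Ioo (0 : ℝ) 1)
    {h : Fin k → 𝒞} (hp : 0 < density γ D h) : IsReweighting (reweighted γ D h) D := by
  refine ⟨⟨?_⟩, (Real.toNNReal (density γ D h))⁻¹, ?_⟩
  · rw [reweighted, Measure.smul_apply, withDensity_apply _ MeasurableSet.univ,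
      setLIntegral_univ, lintegral_exampleWeight h𝒞 hγ, smul_eq_mul,
      ENNReal.inv_mul_cancel (by simpa using hp) ENNReal.ofReal_ne_top]
  · have h1 : D.withDensity (fun e => ENNReal.ofReal (exampleWeight γ h e)) ≤ D := by
      conv_rhs => rw [← withDensity_one (μ := D)]
      exact withDensity_mono (Filter.Eventually.of_forall fun e =>
        ENNReal.ofReal_le_one.2 (exampleWeight_mem_Icc hγ h e).2)
    have h2 : ((Real.toNNReal (density γ D h))⁻¹ : ℝ≥0) • D =
        (ENNReal.ofReal (density γ D h))⁻¹ • D := by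
      rw [ENNReal.ofReal, ← ENNReal.coe_inv (by simpa using hp)]
      rfl
    rw [h2, reweighted]
    refine Measure.le_iff.2 fun s hs => ?_
    simp only [Measure.smul_apply, smul_eq_mul]
    gcongr

/-- The average potential after the votes `h`. -/
noncomputable def avgPotential (γ : ℝ) (D : Measure (X × Bool)) (h : Fin k → 𝒞) : ℝ :=
  ∫ e, votePotential γ (margin h e) ∂D

lemma integrable_votePotential (h𝒞 : IsClassifierSpace 𝒞) (hγ : γ ∈ Set.Ioo (0 : ℝ) 1)
    (h : Fin k → 𝒞) : Integrable (fun e => votePotential γ (margin h e)) D :=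
  integrable_of_measurable_of_mem_Icc
    ((measurable_of_countable (votePotential γ)).comp (measurable_margin_right h𝒞 h))
    (fun e => ⟨neg_le_votePotential hγ (neg_le_margin h e), votePotential_le hγ _⟩)

lemma avgPotential_le (h𝒞 : IsClassifierSpace 𝒞) (hγ : γ ∈ Set.Ioo (0 : ℝ) 1) (h : Fin k → 𝒞) :
    avgPotential γ D h ≤ (1 - γ ^ 2) / (2 * γ) := by
  calc avgPotential γ D h ≤ ∫ _, (1 - γ ^ 2) / (2 * γ) ∂D :=
        integral_mono (integrable_votePotential h𝒞 hγ h) (integrable_const _)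
          fun e => votePotential_le hγ _
    _ = _ := by simp

lemma avgPotential_zero (h : Fin 0 → 𝒞) : avgPotential γ D h = 0 := by
  simp [avgPotential, margin, votePotential, voteWeight]

/-- A vote with an advantage on the reweighted distribution increases the average potential. -/
lemma avgPotential_snoc_ge (h𝒞 : IsClassifierSpace 𝒞) (hγ : γ ∈ Set.Ioo (0 : ℝ) 1)
    {h : Fin k → 𝒞} (hp : 0 < density γ D h) {g : 𝒞}
    (hg : err (reweighted γ D h) (g : X → Bool) ≤ 1 / 2 - γ) :
    avgPotential γ D h + γ * density γ D h ≤
      avgPotential γ D (Fin.snoc h g : Fin (k + 1) → 𝒞) := by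
  set W := {e : X × Bool | (g : X → Bool) e.1 ≠ e.2}
  have hW : MeasurableSet W := measurableSet_ne_label_right h𝒞 g
  have hi := integrable_exampleWeight (D := D) h𝒞 hγ h
  -- The error under `reweighted` is the weight of the misclassified examples divided by the
  -- density.
  have herr : ∫ e in W, exampleWeight γ h e ∂D ≤ (1 / 2 - γ) * density γ D h := by
    have h1 : err (reweighted γ D h) (g : X → Bool) =
        (density γ D h)⁻¹ * ∫ e in W, exampleWeight γ h e ∂D := by
      rw [err, Measure.real, reweighted, Measure.smul_apply, withDensity_apply _ hW,
        ← ofReal_integral_eq_lintegral_ofReal hi.integrableOn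
          (Filter.Eventually.of_forall fun e => (exampleWeight_mem_Icc hγ h e).1),
        smul_eq_mul, ENNReal.toReal_mul, ENNReal.toReal_inv, ENNReal.toReal_ofReal hp.le,
        ENNReal.toReal_ofReal (integral_nonneg fun e => (exampleWeight_mem_Icc hγ h e).1)]
    rw [h1, inv_mul_le_iff₀ hp] at hg
    linarith
  have hWi : Integrable (fun e => W.indicator (exampleWeight γ h) e) D := hi.indicator hW
  -- The lower bound on the increment is `w * (1 - γ)` on correct and `w * (1 - γ) - 2 * w` on wrong
  -- examples. Its mean is at least `(1 - γ) - (1 - 2 * γ) = γ` times the density: half of the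
  -- correlation `2 * γ` is spent on the potential.
  have hpt : ∀ e, votePotential γ (margin h e) + (exampleWeight γ h e * (1 - γ) -
      2 * W.indicator (exampleWeight γ h) e) ≤
      votePotential γ (margin (Fin.snoc h g : Fin (k + 1) → 𝒞) e) := by
    intro e
    rw [margin_snoc]
    by_cases he : e ∈ W
    · have hv : vote g e = -1 := if_neg he
      rw [hv, Set.indicator_of_mem he]
      have := votePotential_sub_one hγ (margin h e)
      simp only [exampleWeight]
      rw [← sub_eq_add_neg]
      linarith
    · have hv : vote g e = 1 := if_pos (not_not.1 he)
      rw [hv, Set.indicator_of_notMem he]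
      have := votePotential_add_one hγ (margin h e)
      simp only [exampleWeight]
      linarith
  have hdiff : Integrable (fun e => exampleWeight γ h e * (1 - γ) -
      2 * W.indicator (exampleWeight γ h) e) D := (hi.mul_const _).sub (hWi.const_mul 2)
  have hsum : Integrable (fun e => votePotential γ (margin h e) + (exampleWeight γ h e * (1 - γ) -
      2 * W.indicator (exampleWeight γ h) e)) D := (integrable_votePotential h𝒞 hγ h).add hdiff
  have hmono := integral_mono hsum (integrable_votePotential h𝒞 hγ _) hpt
  rw [integral_add (integrable_votePotential h𝒞 hγ h) hdiff,
    integral_sub (hi.mul_const _) (hWi.const_mul 2), integral_mul_const, integral_const_mul,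
    integral_indicator hW] at hmono
  unfold avgPotential
  unfold density at *
  linarith

end Votes

/-! ### The boosting algorithm as a kernel. -/

section Boosting

variable {X : Type*} [MeasurableSpace X] {𝒞 : Set (X → Bool)} {n : ℕ}

/-- Number of examples used in `t` rounds of boosting, each with `M₂` examples for the stopping test
and `M₁` examples for rejection sampling. -/
def boostSamples (M₁ M₂ : ℕ) : ℕ → ℕ
  | 0 => 0
  | t + 1 => M₂ + (M₁ + boostSamples M₁ M₂ t)

lemma boostSamples_eq (M₁ M₂ t : ℕ) : boostSamples M₁ M₂ t = t * (M₂ + M₁) := by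
  induction t with
  | zero => simp [boostSamples]
  | succ t ih => rw [boostSamples, ih]; ring

lemma measurable_stopTest_exampleWeight {Z : Type*} [MeasurableSpace Z] {k M : ℕ}
    (h𝒞 : IsClassifierSpace 𝒞) (γ s ε : ℝ) {f : Z → Fin k → 𝒞} {g : Z → Fin M → X × Bool}
    (hf : Measurable f) (hg : Measurable g) :
    Measurable fun q => stopTest s ε (exampleWeight γ (f q)) (g q) := by
  refine (continuous_stopProb.measurable.comp ?_).ennreal_ofReal
  refine (Finset.measurable_sum _ fun i _ => ?_).div_const _
  have h1 : Measurable fun q => (f q, g q i) := by fun_prop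
  exact (measurable_exampleWeight h𝒞).comp h1

/-- Run the weak learner on examples obtained from rejection sampling. -/
noncomputable def voteKernel (h𝒞 : IsClassifierSpace 𝒞) (γ : ℝ) (e₀ : X × Bool)
    (A : Kernel (Fin n → X × Bool) 𝒞) (M k : ℕ) :
    Kernel ((Fin k → 𝒞) × (Fin M → X × Bool)) 𝒞 :=
  A ∘ₖ rejectionKernel (fun p => ENNReal.ofReal (exampleWeight γ p.1 p.2))
    (measurable_exampleWeight h𝒞).ennreal_ofReal e₀ M n

/-- Add one more vote to the votes of the previous rounds and continue with `N`. -/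
noncomputable def continueKernel (h𝒞 : IsClassifierSpace 𝒞) (γ : ℝ) (e₀ : X × Bool)
    (A : Kernel (Fin n → X × Bool) 𝒞) (M₁ : ℕ) {k m : ℕ}
    (N : Kernel ((Fin (k + 1) → 𝒞) × (Fin m → X × Bool)) 𝒞) :
    Kernel ((Fin k → 𝒞) × ((Fin M₁ → X × Bool) × (Fin m → X × Bool))) 𝒞 :=
  bindKernel ((voteKernel h𝒞 γ e₀ A M₁ k).comap (fun p => (p.1, p.2.1)) (by fun_prop))
    (N.comap (fun q => (Fin.snoc q.2.1 q.1, q.2.2.2))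
      ((measurable_finSnoc (by fun_prop) (by fun_prop)).prodMk (by fun_prop)))

/-- Output the majority vote if the stopping test succeeds, and continue with one more vote
otherwise. -/
noncomputable def roundKernel (h𝒞 : IsClassifierSpace 𝒞) (γ s ε : ℝ) (e₀ : X × Bool)
    (A : Kernel (Fin n → X × Bool) 𝒞) (M₁ M₂ : ℕ) {k m : ℕ}
    (N : Kernel ((Fin (k + 1) → 𝒞) × (Fin m → X × Bool)) 𝒞) :
    Kernel ((Fin k → 𝒞) × ((Fin M₂ → X × Bool) ×
      ((Fin M₁ → X × Bool) × (Fin m → X × Bool)))) 𝒞 :=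
  mixKernel (fun p => stopTest s ε (exampleWeight γ p.1) p.2.1)
    (measurable_stopTest_exampleWeight h𝒞 γ s ε measurable_fst (by fun_prop))
    (Kernel.deterministic (fun p => majority h𝒞 p.1)
      ((measurable_majority h𝒞).comp measurable_fst))
    ((continueKernel h𝒞 γ e₀ A M₁ N).comap (fun p => (p.1, p.2.2)) (by fun_prop))

/-- Split the examples for one round and the remaining rounds. -/
def splitRound {E : Type*} (a b c : ℕ) (S : Fin (a + (b + c)) → E) :
    (Fin a → E) × ((Fin b → E) × (Fin c → E)) :=
  Prod.map id (splitSample b c) (splitSample a (b + c) S)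

lemma measurable_splitRound {E : Type*} [MeasurableSpace E] (a b c : ℕ) :
    Measurable (splitRound a b c : (Fin (a + (b + c)) → E) → _) :=
  (measurable_id.prodMap (measurable_splitSample b c)).comp (measurable_splitSample a (b + c))

lemma measurePreserving_splitRound (D : Measure (X × Bool)) [IsProbabilityMeasure D] (a b c : ℕ) :
    MeasurePreserving (splitRound a b c) (sampleLaw D (a + (b + c)))
      ((sampleLaw D a).prod ((sampleLaw D b).prod (sampleLaw D c))) :=
  ((MeasurePreserving.id _).prod (measurePreserving_splitSample D b c)).comp
    (measurePreserving_splitSample D a (b + c))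

/-- Boosting for `t` further rounds, given the votes of the previous rounds. -/
noncomputable def boostKernel (h𝒞 : IsClassifierSpace 𝒞) (γ s ε : ℝ) (e₀ : X × Bool)
    (A : Kernel (Fin n → X × Bool) 𝒞) (M₁ M₂ : ℕ) :
    ∀ t k : ℕ, Kernel ((Fin k → 𝒞) × (Fin (boostSamples M₁ M₂ t) → X × Bool)) 𝒞
  | 0, _ => Kernel.deterministic (fun p => majority h𝒞 p.1)
      ((measurable_majority h𝒞).comp measurable_fst)
  | t + 1, k => (roundKernel h𝒞 γ s ε e₀ A M₁ M₂ (boostKernel h𝒞 γ s ε e₀ A M₁ M₂ t (k + 1))).comap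
      (fun p => (p.1, splitRound M₂ M₁ (boostSamples M₁ M₂ t) p.2))
      (measurable_fst.prodMk ((measurable_splitRound _ _ _).comp measurable_snd))

variable {h𝒞 : IsClassifierSpace 𝒞} {γ s ε : ℝ} {e₀ : X × Bool}
  {A : Kernel (Fin n → X × Bool) 𝒞} [IsMarkovKernel A] {M₁ M₂ k m : ℕ}

lemma isMarkovKernel_voteKernel (hγ : γ ∈ Set.Ioo (0 : ℝ) 1) :
    IsMarkovKernel (voteKernel h𝒞 γ e₀ A M₁ k) := by
  have := isMarkovKernel_rejectionKernel
    (measurable_exampleWeight (k := k) (γ := γ) h𝒞).ennreal_ofReal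
    (fun p => ENNReal.ofReal_le_one.2 (exampleWeight_mem_Icc hγ p.1 p.2).2) e₀ M₁ n
  unfold voteKernel
  infer_instance

section Round

variable (N : Kernel ((Fin (k + 1) → 𝒞) × (Fin m → X × Bool)) 𝒞)

lemma isMarkovKernel_continueKernel (hγ : γ ∈ Set.Ioo (0 : ℝ) 1) [IsMarkovKernel N] :
    IsMarkovKernel (continueKernel h𝒞 γ e₀ A M₁ N) := by
  have := isMarkovKernel_voteKernel (h𝒞 := h𝒞) (e₀ := e₀) (A := A) (M₁ := M₁) (k := k) hγ
  unfold continueKernel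
  infer_instance

lemma isMarkovKernel_roundKernel (hγ : γ ∈ Set.Ioo (0 : ℝ) 1) [IsMarkovKernel N] :
    IsMarkovKernel (roundKernel h𝒞 γ s ε e₀ A M₁ M₂ N) := by
  have := isMarkovKernel_continueKernel (h𝒞 := h𝒞) (e₀ := e₀) (A := A) (M₁ := M₁) N hγ
  exact isMarkovKernel_mixKernel _ (fun p => stopTest_le_one _ _) _ _

lemma continueKernel_apply (hγ : γ ∈ Set.Ioo (0 : ℝ) 1) (h : Fin k → 𝒞) (z : Fin M₁ → X × Bool)
    (S : Fin m → X × Bool) :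
    continueKernel h𝒞 γ e₀ A M₁ N (h, z, S) =
      (voteKernel h𝒞 γ e₀ A M₁ k (h, z)).bind (N.comap (fun g => (Fin.snoc h g, S))
        ((measurable_finSnoc measurable_id measurable_const).prodMk measurable_const)) := by
  have := isMarkovKernel_voteKernel (h𝒞 := h𝒞) (e₀ := e₀) (A := A) (M₁ := M₁) (k := k) hγ
  rw [continueKernel, bindKernel_apply]
  rfl

lemma roundKernel_apply (h : Fin k → 𝒞) (z : Fin M₂ → X × Bool)
    (S : (Fin M₁ → X × Bool) × (Fin m → X × Bool)) :
    roundKernel h𝒞 γ s ε e₀ A M₁ M₂ N (h, z, S) =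
      stopTest s ε (exampleWeight γ h) z • Measure.dirac (majority h𝒞 h) +
        (1 - stopTest s ε (exampleWeight γ h) z) • continueKernel h𝒞 γ e₀ A M₁ N (h, S) := by
  rw [roundKernel, mixKernel_apply, Kernel.deterministic_apply]
  rfl

end Round

lemma isMarkovKernel_boostKernel (hγ : γ ∈ Set.Ioo (0 : ℝ) 1) :
    ∀ t k : ℕ, IsMarkovKernel (boostKernel h𝒞 γ s ε e₀ A M₁ M₂ t k)
  | 0, _ => by rw [boostKernel]; infer_instance
  | t + 1, k => by
    have h1 := isMarkovKernel_boostKernel hγ t (k + 1)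
    have h2 := isMarkovKernel_roundKernel (h𝒞 := h𝒞) (s := s) (ε := ε) (e₀ := e₀) (A := A)
      (M₁ := M₁) (M₂ := M₂) (boostKernel h𝒞 γ s ε e₀ A M₁ M₂ t (k + 1)) hγ
    rw [boostKernel]
    infer_instance

end Boosting

/-! ### Indistinguishability and accuracy of boosting. -/

section Analysis

variable {X : Type*} [MeasurableSpace X] {𝒞 : Set (X → Bool)} {n : ℕ}
  {h𝒞 : IsClassifierSpace 𝒞} {γ s ε : ℝ} {e₀ : X × Bool}
  {A : Kernel (Fin n → X × Bool) 𝒞} [IsMarkovKernel A] {M₁ M₂ k : ℕ}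
  {D : Measure (X × Bool)} [IsProbabilityMeasure D]

lemma density_mem_Icc (hγ : γ ∈ Set.Ioo (0 : ℝ) 1) (h : Fin k → 𝒞) :
    density γ D h ∈ Set.Icc (0 : ℝ) 1 :=
  ⟨integral_nonneg fun e => (exampleWeight_mem_Icc hγ h e).1, by
    have := integral_mono_of_nonneg (μ := D)
      (Filter.Eventually.of_forall fun e => (exampleWeight_mem_Icc hγ h e).1)
      (integrable_const (1 : ℝ))
      (Filter.Eventually.of_forall fun e => (exampleWeight_mem_Icc hγ h e).2)
    simpa [density] using this⟩

/-- Rejection sampling for boosting: domination by the reweighted distribution. -/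
lemma lintegral_rejectionKernel_exampleWeight_le (hγ : γ ∈ Set.Ioo (0 : ℝ) 1) {h : Fin k → 𝒞}
    (hp : 0 < density γ D h) {δ : ℝ≥0∞}
    (hδ : 2 ^ n * ENNReal.ofReal (1 - density γ D h / 2) ^ M₁ ≤ δ)
    {g : (Fin n → X × Bool) → ℝ≥0∞} (hg : Measurable g) (hg1 : ∀ S, g S ≤ 1) :
    ∫⁻ z, ∫⁻ S, g S ∂(rejectionKernel (fun p => ENNReal.ofReal (exampleWeight γ p.1 p.2))
        (measurable_exampleWeight h𝒞).ennreal_ofReal e₀ M₁ n (h, z)) ∂(sampleLaw D M₁) ≤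
      ∫⁻ S, g S ∂(sampleLaw (reweighted γ D h) n) + δ := by
  have := (isReweighting_reweighted h𝒞 hγ hp).1
  have hp1 := (density_mem_Icc (D := D) hγ h).2
  have hsum : ENNReal.ofReal (density γ D h) / 2 + ENNReal.ofReal (1 - density γ D h) =
      ENNReal.ofReal (1 - density γ D h / 2) := by
    rw [← ENNReal.ofReal_ofNat 2, ← ENNReal.ofReal_div_of_pos (by norm_num),
      ← ENNReal.ofReal_add (by linarith) (by linarith)]
    congr 1; ring
  refine (lintegral_rejectionKernel_le (measurable_exampleWeight h𝒞).ennreal_ofReal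
    (fun p => ENNReal.ofReal_le_one.2 (exampleWeight_mem_Icc hγ p.1 p.2).2) e₀ h D
    (reweighted γ D h) (withDensity_eq_smul_reweighted hp)
    (lintegral_one_sub_exampleWeight h𝒞 hγ h) M₁ n g hg hg1).trans ?_
  rw [hsum]
  gcongr

lemma lintegral_voteKernel_le (hγ : γ ∈ Set.Ioo (0 : ℝ) 1) {h : Fin k → 𝒞}
    (hp : 0 < density γ D h) {δ : ℝ≥0∞}
    (hδ : 2 ^ n * ENNReal.ofReal (1 - density γ D h / 2) ^ M₁ ≤ δ)
    {E : Set 𝒞} (hE : MeasurableSet E) :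
    ∫⁻ z, voteKernel h𝒞 γ e₀ A M₁ k (h, z) E ∂(sampleLaw D M₁) ≤
      ∫⁻ S, A S E ∂(sampleLaw (reweighted γ D h) n) + δ := by
  simp_rw [voteKernel, Kernel.comp_apply' _ _ _ hE]
  exact lintegral_rejectionKernel_exampleWeight_le (h𝒞 := h𝒞) hγ hp hδ (A.measurable_coe hE)
    fun _ => prob_le_one

/-- By joint convexity, the outputs are compared through the two rejection samples. These are
replaced one after the other by i.i.d. samples from the reweighted distribution, at the cost of `δ`
each. -/
lemma avgTV_voteKernel_le (hγ : γ ∈ Set.Ioo (0 : ℝ) 1) {h : Fin k → 𝒞}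
    (hp : 0 < density γ D h) {δ : ℝ≥0∞}
    (hδ : 2 ^ n * ENNReal.ofReal (1 - density γ D h / 2) ^ M₁ ≤ δ) :
    avgTV ((voteKernel h𝒞 γ e₀ A M₁ k).comap (fun z => (h, z)) measurable_prodMk_left)
        (sampleLaw D M₁) ≤
      avgTV A (sampleLaw (reweighted γ D h) n) + 2 * δ := by
  have := h𝒞.countablyGenerated
  have := (isReweighting_reweighted h𝒞 hγ hp).1
  have := isMarkovKernel_rejectionKernel
    (measurable_exampleWeight (k := k) (γ := γ) h𝒞).ennreal_ofReal
    (fun p => ENNReal.ofReal_le_one.2 (exampleWeight_mem_Icc hγ p.1 p.2).2) e₀ M₁ n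
  have hle := fun g hg hg1 => lintegral_rejectionKernel_exampleWeight_le (h𝒞 := h𝒞) (e₀ := e₀)
    hγ hp hδ (g := g) hg hg1
  set R := rejectionKernel (fun p : (Fin k → 𝒞) × (X × Bool) =>
    ENNReal.ofReal (exampleWeight γ p.1 p.2)) (measurable_exampleWeight h𝒞).ennreal_ofReal e₀ M₁ n
    with hR
  set D' := reweighted γ D h
  have hA : Measurable fun p : (Fin n → X × Bool) × (Fin n → X × Bool) =>
      tvDist (A p.1) (A p.2) := measurable_tvDist A A measurable_fst measurable_snd
  have hA1 : ∀ S, Measurable fun S' => tvDist (A S) (A S') := fun S =>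
    hA.comp measurable_prodMk_left
  have hA2 : Measurable fun S => ∫⁻ S', tvDist (A S) (A S') ∂(sampleLaw D' n) :=
    hA.lintegral_prod_right'
  have hA3 : ∀ S, ∫⁻ S', tvDist (A S) (A S') ∂(sampleLaw D' n) ≤ 1 := fun S => by
    calc _ ≤ ∫⁻ _, 1 ∂(sampleLaw D' n) := by gcongr; exact tvDist_le_one _ _
      _ = 1 := by simp
  calc _ ≤ ∫⁻ z, ∫⁻ z', ∫⁻ S, ∫⁻ S', tvDist (A S) (A S') ∂(R (h, z')) ∂(R (h, z))
          ∂(sampleLaw D M₁) ∂(sampleLaw D M₁) := by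
        unfold avgTV
        gcongr with z z'
        simp only [Kernel.comap_apply, voteKernel, Kernel.comp_apply]
        exact tvDist_bind_le _ _ _
    _ = ∫⁻ z, ∫⁻ S, ∫⁻ z', ∫⁻ S', tvDist (A S) (A S') ∂(R (h, z')) ∂(sampleLaw D M₁) ∂(R (h, z))
          ∂(sampleLaw D M₁) := by
        refine lintegral_congr fun z => lintegral_lintegral_swap ?_
        refine Measurable.aemeasurable ?_
        exact Measurable.lintegral_kernel_prod_right'
          (κ := R.comap (fun p : (Fin M₁ → X × Bool) × (Fin n → X × Bool) => (h, p.1))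
            (by fun_prop))
          (f := fun q : ((Fin M₁ → X × Bool) × (Fin n → X × Bool)) × (Fin n → X × Bool) =>
            tvDist (A q.1.2) (A q.2)) (measurable_tvDist A A (by fun_prop) (by fun_prop))
    _ ≤ ∫⁻ z, ∫⁻ S, (∫⁻ S', tvDist (A S) (A S') ∂(sampleLaw D' n) + δ) ∂(R (h, z))
          ∂(sampleLaw D M₁) := by
        gcongr with z S
        exact hle _ (hA1 S) fun _ => tvDist_le_one _ _
    _ = ∫⁻ z, ∫⁻ S, ∫⁻ S', tvDist (A S) (A S') ∂(sampleLaw D' n) ∂(R (h, z))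
          ∂(sampleLaw D M₁) + δ := by
        simp_rw [lintegral_add_right _ measurable_const, lintegral_const, measure_univ, mul_one]
        rw [lintegral_add_right _ measurable_const, lintegral_const, measure_univ, mul_one]
    _ ≤ (avgTV A (sampleLaw D' n) + δ) + δ := by
        gcongr
        exact hle _ hA2 hA3
    _ = _ := by ring

/-- Total variation indistinguishability of boosting. -/
lemma avgTV_boostKernel_le (hγ : γ ∈ Set.Ioo (0 : ℝ) 1) (hs : 0 < s) (hε : 0 < ε) (hM₂ : 0 < M₂)
    {L : ℝ} (hL : 4 ≤ L) (hLM : L ^ 2 * (4 / ε * Real.log ((1 + s) / s)) ^ 2 ≤ M₂)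
    {δ r : ℝ≥0∞} (hδ₁ : 2 ^ n * ENNReal.ofReal (1 - ε / 8) ^ M₁ ≤ δ)
    (hδ₂ : ENNReal.ofReal (Real.exp (-M₂ * ε ^ 2 / 8)) ≤ δ)
    (hA : ∀ D', IsReweighting D' D → avgTV A (sampleLaw D' n) ≤ r) :
    ∀ (t : ℕ) {k : ℕ} (h : Fin k → 𝒞),
      avgTV ((boostKernel h𝒞 γ s ε e₀ A M₁ M₂ t k).comap (fun S => (h, S)) measurable_prodMk_left)
        (sampleLaw D (boostSamples M₁ M₂ t)) ≤
      t * (r + 3 * δ + ENNReal.ofReal (8 / L) * ENNReal.ofReal s) + ENNReal.ofReal (8 / L)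
  | 0, k, h => by
    simp [avgTV, boostKernel, Kernel.comap_apply, Kernel.deterministic_apply]
  | t + 1, k, h => by
    have := h𝒞.countablyGenerated
    set c := ENNReal.ofReal (8 / L)
    set v := t * (r + 3 * δ + c * ENNReal.ofReal s) + c with hv
    set N := boostKernel h𝒞 γ s ε e₀ A M₁ M₂ t (k + 1)
    have : IsMarkovKernel N := isMarkovKernel_boostKernel hγ t (k + 1)
    have : IsMarkovKernel (voteKernel h𝒞 γ e₀ A M₁ k) := isMarkovKernel_voteKernel hγ
    have : IsMarkovKernel (continueKernel h𝒞 γ e₀ A M₁ N) := isMarkovKernel_continueKernel N hγ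
    have : IsMarkovKernel (roundKernel h𝒞 γ s ε e₀ A M₁ M₂ N) := isMarkovKernel_roundKernel N hγ
    have hwm := measurable_exampleWeight_right (γ := γ) h𝒞 h
    have hw1 := exampleWeight_mem_Icc hγ h
    set V := (voteKernel h𝒞 γ e₀ A M₁ k).comap (fun z => (h, z)) measurable_prodMk_left with hV
    set Q := (continueKernel h𝒞 γ e₀ A M₁ N).comap (fun S => (h, S)) measurable_prodMk_left
      with hQ
    set f := stopTest (M := M₂) s ε (exampleWeight γ h) with hf
    have hfm : Measurable f := measurable_stopTest hwm
    -- The new vote is compared first; once it is common to both runs, the induction hypothesis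
    -- applies to the longer list of votes.
    have hQle : avgTV Q ((sampleLaw D M₁).prod (sampleLaw D (boostSamples M₁ M₂ t))) ≤
        avgTV V (sampleLaw D M₁) + v := by
      refine (avgTV_bind_le Q V (N.comap (fun q => (Fin.snoc h q.1, q.2))
        ((measurable_finSnoc measurable_fst measurable_const).prodMk measurable_snd))
        (fun z S => continueKernel_apply N hγ h z S) _ _).trans ?_
      gcongr
      calc _ ≤ ∫⁻ z, ∫⁻ _, v ∂(V z) ∂(sampleLaw D M₁) := by
            gcongr with z g
            exact avgTV_boostKernel_le hγ hs hε hM₂ hL hLM hδ₁ hδ₂ hA t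
              (Fin.snoc h g : Fin (k + 1) → 𝒞)
        _ = v := by simp
    have hround : avgTV ((boostKernel h𝒞 γ s ε e₀ A M₁ M₂ (t + 1) k).comap (fun S => (h, S))
        measurable_prodMk_left) (sampleLaw D (boostSamples M₁ M₂ (t + 1))) =
        avgTV ((roundKernel h𝒞 γ s ε e₀ A M₁ M₂ N).comap (fun S => (h, S)) measurable_prodMk_left)
          ((sampleLaw D M₂).prod ((sampleLaw D M₁).prod (sampleLaw D (boostSamples M₁ M₂ t)))) := by
      rw [← avgTV_comap _ (measurePreserving_splitRound D M₂ M₁ (boostSamples M₁ M₂ t))]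
      rfl
    have hsum : ∫⁻ z, f z ∂(sampleLaw D M₂) + ∫⁻ z, (1 - f z) ∂(sampleLaw D M₂) = 1 := by
      rw [← lintegral_add_left hfm]
      simp [hf, add_tsub_cancel_of_le (stopTest_le_one _ _)]
    have htest := lintegral_stopTest_sub_le (D := D) hwm hw1 hM₂ hs hε hL hLM
    rw [hround]
    refine (avgTV_mix_le _ Q hfm (fun z => stopTest_le_one _ z) (Measure.dirac (majority h𝒞 h))
      (fun z S => roundKernel_apply N h z S) _ _).trans ?_
    set F := ∫⁻ z, f z ∂(sampleLaw D M₂)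
    set G := ∫⁻ z, (1 - f z) ∂(sampleLaw D M₂) with hG
    have hG1 : G ≤ 1 := hsum ▸ le_add_self
    -- Rejection sampling may be useless at low density, but then continuing has probability at most
    -- `δ`, so the factor `G` rescues the bound.
    have hcont : G * avgTV V (sampleLaw D M₁) ≤ r + 3 * δ := by
      rcases le_or_gt (density γ D h) (ε / 4) with hp | hp
      · calc G * avgTV V (sampleLaw D M₁) ≤ δ * 1 := by
              gcongr
              · exact (lintegral_one_sub_stopTest_le hwm hw1 hM₂ hs hε hp).trans hδ₂
              · exact avgTV_le_one _ _
          _ = δ := mul_one δ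
          _ ≤ 3 * δ := le_mul_of_one_le_left' (by norm_num)
          _ ≤ r + 3 * δ := le_add_self
      · have hp0 : 0 < density γ D h := by linarith
        calc G * avgTV V (sampleLaw D M₁) ≤ 1 * (avgTV A (sampleLaw (reweighted γ D h) n) + 2 * δ) := by
              gcongr
              refine avgTV_voteKernel_le hγ hp0 (le_trans ?_ hδ₁)
              gcongr 2 ^ n * ENNReal.ofReal (1 - ?_) ^ M₁
              linarith
          _ ≤ r + 3 * δ := by
              rw [one_mul]
              gcongr
              · exact hA _ (isReweighting_reweighted h𝒞 hγ hp0)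
              · norm_num
    calc _ ≤ c * (F + ENNReal.ofReal s) + G * (avgTV V (sampleLaw D M₁) + v) := by gcongr
      _ = c * F + c * ENNReal.ofReal s + G * avgTV V (sampleLaw D M₁) +
          G * (t * (r + 3 * δ + c * ENNReal.ofReal s)) + G * c := by rw [hv]; ring
      _ ≤ c * F + c * ENNReal.ofReal s + (r + 3 * δ) +
          1 * (t * (r + 3 * δ + c * ENNReal.ofReal s)) + G * c := by gcongr
      -- Telescoping: the `c` owed by later rounds is multiplied by the probability `G` of
      -- continuing and joins `c * F` from this round. As `F + G = 1`, the isolated `c` is paid only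
      -- once overall.
      _ = c * (F + G) + (t + 1) * (r + 3 * δ + c * ENNReal.ofReal s) := by ring
      _ = _ := by rw [hsum]; push_cast; ring

/-- Accuracy of boosting: the average potential of the votes cannot stay large. -/
lemma lintegral_boostKernel_err_le (hγ : γ ∈ Set.Ioo (0 : ℝ) 1) (hs : 0 < s) (hε : 0 < ε)
    (hM₂ : 0 < M₂) {δ b : ℝ≥0∞} (hδ₁ : 2 ^ n * ENNReal.ofReal (1 - ε / 8) ^ M₁ ≤ δ)
    (hδ₂ : ENNReal.ofReal (Real.exp (-M₂ * ε ^ 2 / 8)) ≤ δ)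
    (hA : ∀ D', IsReweighting D' D →
      ∫⁻ S, A S {h : 𝒞 | 1 / 2 - γ < err D' (h : X → Bool)} ∂(sampleLaw D' n) ≤ b) :
    ∀ (t : ℕ) {k : ℕ} (h : Fin k → 𝒞),
      (1 - γ ^ 2) / (2 * γ) - t * (γ * (ε / 4)) < avgPotential γ D h →
      ∫⁻ S, boostKernel h𝒞 γ s ε e₀ A M₁ M₂ t k (h, S) {g : 𝒞 | ε < err D (g : X → Bool)}
        ∂(sampleLaw D (boostSamples M₁ M₂ t)) ≤ t * (b + 2 * δ)
  | 0, k, h, hΦ => by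
    -- With no rounds left the hypothesis contradicts the upper bound of the potential, so the
    -- forced final vote needs no analysis.
    have := avgPotential_le (D := D) h𝒞 hγ h
    simp only [CharP.cast_eq_zero, zero_mul, sub_zero] at hΦ
    linarith
  | t + 1, k, h, hΦ => by
    set E := {g : 𝒞 | ε < err D (g : X → Bool)}
    have hE : MeasurableSet E := measurableSet_lt measurable_const (measurable_err h𝒞 D)
    set N := boostKernel h𝒞 γ s ε e₀ A M₁ M₂ t (k + 1)
    have : IsMarkovKernel N := isMarkovKernel_boostKernel hγ t (k + 1)
    have : IsMarkovKernel (voteKernel h𝒞 γ e₀ A M₁ k) := isMarkovKernel_voteKernel hγ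
    have : IsMarkovKernel (continueKernel h𝒞 γ e₀ A M₁ N) := isMarkovKernel_continueKernel N hγ
    have hwm := measurable_exampleWeight_right (γ := γ) h𝒞 h
    have hw1 := exampleWeight_mem_Icc hγ h
    set ν₃ := sampleLaw D (boostSamples M₁ M₂ t)
    set f := stopTest (M := M₂) s ε (exampleWeight γ h) with hf
    have hfm : Measurable f := measurable_stopTest hwm
    set C := ∫⁻ z, continueKernel h𝒞 γ e₀ A M₁ N (h, z) E ∂((sampleLaw D M₁).prod ν₃) with hC
    have hsplit : ∫⁻ S, boostKernel h𝒞 γ s ε e₀ A M₁ M₂ (t + 1) k (h, S) E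
          ∂(sampleLaw D (boostSamples M₁ M₂ (t + 1))) =
        (∫⁻ z, f z ∂(sampleLaw D M₂)) * Measure.dirac (majority h𝒞 h) E +
          (∫⁻ z, (1 - f z) ∂(sampleLaw D M₂)) * C := by
      have hK : Measurable fun S => roundKernel h𝒞 γ s ε e₀ A M₁ M₂ N (h, S) E :=
        ((roundKernel h𝒞 γ s ε e₀ A M₁ M₂ N).measurable_coe hE).comp measurable_prodMk_left
      have hc : Measurable fun z => continueKernel h𝒞 γ e₀ A M₁ N (h, z) E :=
        ((continueKernel h𝒞 γ e₀ A M₁ N).measurable_coe hE).comp measurable_prodMk_left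
      calc _ = ∫⁻ S, roundKernel h𝒞 γ s ε e₀ A M₁ M₂ N (h, S) E
              ∂((sampleLaw D M₂).prod ((sampleLaw D M₁).prod ν₃)) :=
            (measurePreserving_splitRound D M₂ M₁ (boostSamples M₁ M₂ t)).lintegral_comp
              hK
        _ = ∫⁻ z, ∫⁻ S, (f z * Measure.dirac (majority h𝒞 h) E +
              (1 - f z) * continueKernel h𝒞 γ e₀ A M₁ N (h, S) E)
              ∂((sampleLaw D M₁).prod ν₃) ∂(sampleLaw D M₂) := by
            rw [lintegral_prod _ hK.aemeasurable]
            refine lintegral_congr fun z => lintegral_congr fun S => ?_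
            rw [roundKernel_apply]
            rfl
        _ = _ := by
            simp_rw [lintegral_add_left measurable_const, lintegral_const, measure_univ, mul_one,
              lintegral_const_mul _ hc]
            rw [lintegral_add_left (hfm.mul_const _), lintegral_mul_const _ hfm,
              lintegral_mul_const _ (by fun_prop)]
    have hCvote : C = ∫⁻ z, ∫⁻ g, ∫⁻ S, N (Fin.snoc h g, S) E ∂ν₃
        ∂(voteKernel h𝒞 γ e₀ A M₁ k (h, z)) ∂(sampleLaw D M₁) := by
      have hc : Measurable fun z => continueKernel h𝒞 γ e₀ A M₁ N (h, z) E :=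
        ((continueKernel h𝒞 γ e₀ A M₁ N).measurable_coe hE).comp measurable_prodMk_left
      rw [hC, lintegral_prod _ hc.aemeasurable]
      refine lintegral_congr fun z => ?_
      have h1 : ∀ S, continueKernel h𝒞 γ e₀ A M₁ N (h, z, S) E =
          ∫⁻ g, N (Fin.snoc h g, S) E ∂(voteKernel h𝒞 γ e₀ A M₁ k (h, z)) := fun S => by
        rw [continueKernel_apply N hγ, Measure.bind_apply hE (Kernel.measurable _).aemeasurable]
        rfl
      simp_rw [h1]
      rw [lintegral_lintegral_swap]
      exact ((N.measurable_coe hE).comp ((measurable_finSnoc (n := k)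
        (f := fun p : (Fin (boostSamples M₁ M₂ t) → X × Bool) × 𝒞 => p.2) (g := fun _ => h)
        measurable_snd measurable_const).prodMk measurable_fst)).aemeasurable
    have hC1 : C ≤ 1 := by
      calc C ≤ ∫⁻ _, 1 ∂((sampleLaw D M₁).prod ν₃) := by rw [hC]; gcongr; exact prob_le_one
        _ = 1 := by simp
    have hG1 : ∫⁻ z, (1 - f z) ∂(sampleLaw D M₂) ≤ 1 := by
      calc _ ≤ ∫⁻ _, 1 ∂(sampleLaw D M₂) := by gcongr; exact tsub_le_self
        _ = 1 := by simp
    -- Stopping is harmful only if the majority is inaccurate; then the density is at least `ε` and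
    -- the test rarely stops.
    have hfirst : (∫⁻ z, f z ∂(sampleLaw D M₂)) * Measure.dirac (majority h𝒞 h) E ≤ δ := by
      by_cases hmaj : majority h𝒞 h ∈ E
      · have hp : ε ≤ density γ D h := le_trans (le_of_lt hmaj) (err_majority_le h𝒞 hγ h)
        calc _ ≤ δ * 1 := by
              gcongr
              · exact (lintegral_stopTest_le hwm hw1 hM₂ hs hε hp).trans hδ₂
              · exact prob_le_one
          _ = δ := mul_one δ
      · simp [Measure.dirac_apply' _ hE, hmaj]
    have hsecond : (∫⁻ z, (1 - f z) ∂(sampleLaw D M₂)) * C ≤ b + δ + t * (b + 2 * δ) := by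
      rcases le_or_gt (density γ D h) (ε / 4) with hp | hp
      · calc _ ≤ δ * 1 := by
              gcongr
              exact (lintegral_one_sub_stopTest_le hwm hw1 hM₂ hs hε hp).trans hδ₂
          _ = δ := mul_one δ
          _ ≤ b + δ := le_add_self
          _ ≤ _ := le_self_add
      · have hp0 : 0 < density γ D h := by linarith
        set W := {g : 𝒞 | 1 / 2 - γ < err (reweighted γ D h) (g : X → Bool)}
        have := (isReweighting_reweighted h𝒞 hγ hp0).1
        have hW : MeasurableSet W :=
          measurableSet_lt measurable_const (measurable_err h𝒞 (reweighted γ D h))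
        -- Outside the set `W` of votes without advantage, the potential grows by more than `γ * (ε
        -- / 4)`, which restores the hypothesis for one round less.
        have hbound : ∀ g, ∫⁻ S, N (Fin.snoc h g, S) E ∂ν₃ ≤ W.indicator 1 g + t * (b + 2 * δ) := by
          intro g
          by_cases hg : g ∈ W
          · calc _ ≤ ∫⁻ _, 1 ∂ν₃ := by gcongr; exact prob_le_one
              _ = 1 := by simp [ν₃]
              _ ≤ _ := by simp [hg]
          · have hpot := avgPotential_snoc_ge h𝒞 hγ hp0 (not_lt.1 hg)
            refine (lintegral_boostKernel_err_le hγ hs hε hM₂ hδ₁ hδ₂ hA t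
              (Fin.snoc h g : Fin (k + 1) → 𝒞) ?_).trans le_add_self
            have h1 : γ * (ε / 4) < γ * density γ D h := mul_lt_mul_of_pos_left hp hγ.1
            push_cast at hΦ
            linarith
        calc _ ≤ 1 * C := by gcongr
          _ ≤ ∫⁻ z, ∫⁻ g, (W.indicator 1 g + t * (b + 2 * δ))
                ∂(voteKernel h𝒞 γ e₀ A M₁ k (h, z)) ∂(sampleLaw D M₁) := by
              rw [one_mul, hCvote]
              gcongr with z g
              exact hbound g
          _ = ∫⁻ z, voteKernel h𝒞 γ e₀ A M₁ k (h, z) W ∂(sampleLaw D M₁) + t * (b + 2 * δ) := by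
              simp_rw [lintegral_add_right _ measurable_const, lintegral_const, measure_univ,
                mul_one, lintegral_indicator_one hW]
              rw [lintegral_add_right _ measurable_const, lintegral_const, measure_univ, mul_one]
          _ ≤ _ := by
              gcongr
              refine (lintegral_voteKernel_le hγ hp0 (le_trans ?_ hδ₁) hW).trans ?_
              · gcongr 2 ^ n * ENNReal.ofReal (1 - ?_) ^ M₁
                linarith
              · gcongr
                exact hA _ (isReweighting_reweighted h𝒞 hγ hp0)
    rw [hsplit]
    calc _ ≤ δ + (b + δ + t * (b + 2 * δ)) := add_le_add hfirst hsecond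
      _ = _ := by push_cast; ring

end Analysis

/-! ### Numerical estimates for the parameters. -/

section Parameters

variable {X : Type*} [MeasurableSpace X] {𝒞 : Set (X → Bool)}

lemma tvIndistinguishable_iff (h𝒞 : IsClassifierSpace 𝒞) {n : ℕ}
    (A : Kernel (Fin n → X × Bool) 𝒞) [IsMarkovKernel A] (D : Measure (X × Bool))
    [IsProbabilityMeasure D] (ρ : ℝ) :
    TVIndistinguishable A D ρ ↔ avgTV A (sampleLaw D n) ≤ ENNReal.ofReal ρ := by
  have := h𝒞.countablyGenerated
  rw [TVIndistinguishable, avgTV,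
    lintegral_prod _ (measurable_tvDist A A measurable_fst measurable_snd).aemeasurable]

/-- Here `ε / 8` is half of the smallest density `ε / 4` at which rejection sampling has to work.
The proof uses `2 ≤ e` and `1 - x ≤ exp (-x)`. -/
lemma two_pow_mul_ofReal_pow_le {n M : ℕ} {ε δ : ℝ} (hε : 0 < ε) (hε1 : ε < 1) (hδ : 0 < δ)
    (hM : 8 / ε * (n + Real.log (1 / δ)) ≤ M) :
    2 ^ n * ENNReal.ofReal (1 - ε / 8) ^ M ≤ ENNReal.ofReal δ := by
  rw [← ENNReal.ofReal_ofNat 2, ← ENNReal.ofReal_pow (by norm_num),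
    ← ENNReal.ofReal_pow (by linarith), ← ENNReal.ofReal_mul (by positivity)]
  refine ENNReal.ofReal_le_ofReal ?_
  have h1 : (1 - ε / 8) ^ M ≤ Real.exp (-(ε / 8) * M) := by
    calc (1 - ε / 8) ^ M ≤ Real.exp (-(ε / 8)) ^ M := by
          gcongr
          · linarith
          · linarith [Real.add_one_le_exp (-(ε / 8))]
      _ = _ := by rw [← Real.exp_nat_mul]; ring_nf
  have h2 : (2 : ℝ) ^ n ≤ Real.exp n := by
    calc (2 : ℝ) ^ n ≤ Real.exp 1 ^ n := by
          gcongr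
          linarith [Real.add_one_le_exp 1]
      _ = _ := by rw [← Real.exp_nat_mul, mul_one]
  have h3 : n + Real.log (1 / δ) ≤ ε / 8 * M := by
    calc n + Real.log (1 / δ) = ε / 8 * (8 / ε * (n + Real.log (1 / δ))) := by field_simp
      _ ≤ _ := by gcongr
  calc (2 : ℝ) ^ n * (1 - ε / 8) ^ M ≤ Real.exp n * Real.exp (-(ε / 8) * M) := by
        gcongr
        exact pow_nonneg (by linarith) _
    _ = Real.exp (n - ε / 8 * M) := by rw [← Real.exp_add]; ring_nf
    _ ≤ Real.exp (-Real.log (1 / δ)) := by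
        refine Real.exp_le_exp.2 ?_
        linarith
    _ = δ := by rw [one_div, Real.log_inv, neg_neg, Real.exp_log hδ]

lemma exp_neg_mul_le {M : ℕ} {ε δ : ℝ} (hε : 0 < ε) (hδ : 0 < δ)
    (hM : 8 / ε ^ 2 * Real.log (1 / δ) ≤ M) : Real.exp (-M * ε ^ 2 / 8) ≤ δ := by
  calc Real.exp (-M * ε ^ 2 / 8) ≤ Real.exp (-Real.log (1 / δ)) := by
        refine Real.exp_le_exp.2 ?_
        have : Real.log (1 / δ) ≤ ε ^ 2 / 8 * M := by
          calc Real.log (1 / δ) = ε ^ 2 / 8 * (8 / ε ^ 2 * Real.log (1 / δ)) := by field_simp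
            _ ≤ _ := by gcongr
        linarith
    _ = δ := by rw [one_div, Real.log_inv, neg_neg, Real.exp_log hδ]

variable {γ ε β ρ : ℝ}

lemma log_one_div_nonneg {x : ℝ} (hx : x ∈ Set.Ioo (0 : ℝ) 1) : 0 ≤ Real.log (1 / x) :=
  Real.log_nonneg ((one_le_div hx.1).2 hx.2.le)

lemma log_inv_failure_le (hγ : γ ∈ Set.Ioo (0 : ℝ) 1) (hε : ε ∈ Set.Ioo (0 : ℝ) 1)
    (hβ : β ∈ Set.Ioo (0 : ℝ) 1) (hρ : ρ ∈ Set.Ioo (0 : ℝ) 1) :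
    Real.log (1 / (β * ρ * ε * γ ^ 2 / 100)) ≤
      5 * (1 + Real.log (1 / β)) * (1 + Real.log (1 / (ε * γ * ρ))) := by
  have hb := log_one_div_nonneg hβ
  have hg := log_one_div_nonneg hγ
  have he := log_one_div_nonneg hε
  have hr := log_one_div_nonneg hρ
  obtain ⟨h1, -⟩ := hγ
  obtain ⟨h2, -⟩ := hε
  obtain ⟨h3, -⟩ := hβ
  obtain ⟨h4, -⟩ := hρ
  have h100 : Real.log 100 ≤ 5 := by
    rw [Real.log_le_iff_le_exp (by norm_num), show (5 : ℝ) = 5 * 1 by norm_num,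
      show Real.exp (5 * 1) = Real.exp 1 ^ 5 by rw [← Real.exp_nat_mul]; norm_num]
    calc (100 : ℝ) ≤ 2.7 ^ 5 := by norm_num
      _ ≤ _ := by gcongr; linarith [Real.exp_one_gt_d9]
  simp only [one_div, Real.log_inv] at *
  rw [Real.log_div (by positivity) (by norm_num), Real.log_mul (by positivity) (by positivity),
    Real.log_mul (by positivity) (by positivity), Real.log_mul (by positivity) (by positivity),
    Real.log_pow, Real.log_mul (by positivity) (by positivity),
    Real.log_mul (by positivity) (by positivity)]
  push_cast
  nlinarith [mul_nonneg hb hg, mul_nonneg hb he, mul_nonneg hb hr]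

lemma log_stop_le (hγ : γ ∈ Set.Ioo (0 : ℝ) 1) (hε : ε ∈ Set.Ioo (0 : ℝ) 1)
    (hρ : ρ ∈ Set.Ioo (0 : ℝ) 1) :
    Real.log ((1 + ε * γ ^ 2 / 4) / (ε * γ ^ 2 / 4)) ≤ 3 * (1 + Real.log (1 / (ε * γ * ρ))) := by
  have hg := log_one_div_nonneg hγ
  have he := log_one_div_nonneg hε
  have hr := log_one_div_nonneg hρ
  obtain ⟨h1, h1'⟩ := hγ
  obtain ⟨h2, h2'⟩ := hε
  obtain ⟨h4, -⟩ := hρ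
  have h8 : Real.log 8 ≤ 3 := by
    rw [Real.log_le_iff_le_exp (by norm_num), show (3 : ℝ) = 3 * 1 by norm_num,
      show Real.exp (3 * 1) = Real.exp 1 ^ 3 by rw [← Real.exp_nat_mul]; norm_num]
    calc (8 : ℝ) ≤ 2.7 ^ 3 := by norm_num
      _ ≤ _ := by gcongr; linarith [Real.exp_one_gt_d9]
  have hq : ε * γ ^ 2 ≤ 1 := by nlinarith
  calc Real.log ((1 + ε * γ ^ 2 / 4) / (ε * γ ^ 2 / 4)) ≤ Real.log (8 / (ε * γ ^ 2)) := by
        refine Real.log_le_log (by positivity) ?_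
        rw [div_le_div_iff₀ (by positivity) (by positivity)]
        nlinarith [mul_pos h2 (pow_pos h1 2)]
    _ ≤ _ := by
        simp only [one_div, Real.log_inv] at *
        rw [Real.log_div (by norm_num) (by positivity), Real.log_mul (by positivity) (by positivity),
          Real.log_pow, Real.log_mul (by positivity) (by positivity),
          Real.log_mul (by positivity) (by positivity)]
        push_cast
        linarith

/-- Total number of examples. -/
lemma samples_le {N : ℕ} {T M₁ M₂ a b l ℓ : ℝ} (hγ : γ ∈ Set.Ioo (0 : ℝ) 1)
    (hε : ε ∈ Set.Ioo (0 : ℝ) 1) (hρ : ρ ∈ Set.Ioo (0 : ℝ) 1) (hl : 1 ≤ l) (hℓ : 1 ≤ ℓ)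
    (hT0 : 0 ≤ T) (hT : T ≤ 3 / (ε * γ ^ 2)) (hb0 : 0 ≤ b)
    (ha : a ≤ 5 * l * ℓ) (hb : b ≤ 3 * ℓ) (hM₁ : M₁ ≤ 8 / ε * (N + a) + 1)
    (hM₂ : M₂ ≤ (80 / ρ) ^ 2 * (4 / ε * b) ^ 2 + 8 / ε ^ 2 * a + 1) :
    T * (M₂ + M₁) ≤
      3000000 * (N * l / (ε ^ 2 * γ ^ 2) + l / (ρ ^ 2 * ε ^ 3 * γ ^ 2)) * ℓ ^ 2 := by
  obtain ⟨h1, h1'⟩ := hγ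
  obtain ⟨h2, h2'⟩ := hε
  obtain ⟨h3, h3'⟩ := hρ
  have hN : (0 : ℝ) ≤ N := Nat.cast_nonneg N
  -- The unit `u` absorbs every contribution to a round that does not involve `N`; the dominant
  -- constant is `921600 = 80² * (4 * 3)²`.
  set u := l * ℓ ^ 2 / (ρ ^ 2 * ε ^ 2) with hu
  have hl0 : 0 ≤ l := by linarith
  have hℓ0 : 0 ≤ ℓ := by linarith
  have hll : l * ℓ ≤ l * ℓ ^ 2 := by nlinarith [mul_nonneg hl0 hℓ0]
  have hℓl : ℓ ^ 2 ≤ l * ℓ ^ 2 := by nlinarith [sq_nonneg ℓ]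
  have h1ll : 1 ≤ l * ℓ ^ 2 := by nlinarith [sq_nonneg ℓ]
  have hρ2 : ρ ^ 2 ≤ 1 := by nlinarith
  have hden : ρ ^ 2 * ε ^ 2 ≤ 1 := by nlinarith [sq_nonneg ρ, sq_nonneg ε]
  have e1 : (80 / ρ) ^ 2 * (4 / ε * b) ^ 2 ≤ 921600 * u := by
    calc (80 / ρ) ^ 2 * (4 / ε * b) ^ 2 ≤ (80 / ρ) ^ 2 * (4 / ε * (3 * ℓ)) ^ 2 := by gcongr
      _ = 921600 * (ℓ ^ 2 / (ρ ^ 2 * ε ^ 2)) := by field_simp; ring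
      _ ≤ _ := by rw [hu]; gcongr
  have e2 : 8 / ε ^ 2 * a ≤ 40 * u := by
    calc 8 / ε ^ 2 * a ≤ 8 / ε ^ 2 * (5 * l * ℓ) := by gcongr
      _ = 40 * (l * ℓ / ε ^ 2) := by ring
      _ ≤ 40 * (l * ℓ ^ 2 / (ρ ^ 2 * ε ^ 2)) := by
          gcongr
          nlinarith [sq_nonneg ε]
      _ = _ := by rw [hu]
  have e3 : 1 ≤ u := by
    rw [hu, le_div_iff₀ (by positivity)]; linarith
  have e4 : 8 / ε * a ≤ 40 * u := by
    calc 8 / ε * a ≤ 8 / ε * (5 * l * ℓ) := by gcongr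
      _ = 40 * (l * ℓ / ε) := by ring
      _ ≤ 40 * (l * ℓ ^ 2 / (ρ ^ 2 * ε ^ 2)) := by
          gcongr
          nlinarith [sq_nonneg ε]
      _ = _ := by rw [hu]
  have hu0 : 0 ≤ u := by linarith
  have e5 : M₂ + M₁ ≤ 8 * N / ε + 921682 * u := by
    have : 8 / ε * (N + a) = 8 * N / ε + 8 / ε * a := by ring
    linarith
  calc T * (M₂ + M₁) ≤ T * (8 * N / ε + 921682 * u) := by gcongr
    _ ≤ 3 / (ε * γ ^ 2) * (8 * N / ε + 921682 * u) := by gcongr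
    _ = 24 * (N / (ε ^ 2 * γ ^ 2)) + 2765046 * (l / (ρ ^ 2 * ε ^ 3 * γ ^ 2) * ℓ ^ 2) := by
        rw [hu]; field_simp; ring
    _ ≤ 3000000 * (N / (ε ^ 2 * γ ^ 2) * (l * ℓ ^ 2)) +
          3000000 * (l / (ρ ^ 2 * ε ^ 3 * γ ^ 2) * ℓ ^ 2) := by
        have p1 : 0 ≤ N / (ε ^ 2 * γ ^ 2) := by positivity
        have p2 : 0 ≤ l / (ρ ^ 2 * ε ^ 3 * γ ^ 2) * ℓ ^ 2 := by positivity
        nlinarith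
    _ = _ := by ring

end Parameters

/-! ### Choice of parameters and conclusion. -/

theorem mainTheorem9 :
    ∃ (C : ℝ) (k : ℕ), ∀ {X : Type*} [MeasurableSpace X] (𝒞 : Set (X → Bool)), IsClassifierSpace 𝒞 →
      ∀ (γ : ℝ), γ ∈ Set.Ioo (0 : ℝ) 1 →
      ∀ (n : ℝ → ℝ → ℕ) (A : ∀ β ρ : ℝ, Kernel (Fin (n β ρ) → X × Bool) 𝒞)
        (P : ℝ → ℝ → Measure 𝒞),
      (∀ β ρ, IsMarkovKernel (A β ρ)) → (∀ β ρ, IsProbabilityMeasure (P β ρ)) →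
      ∀ ρ' ∈ Set.Ioo (0 : ℝ) 1, ∀ ε ∈ Set.Ioo (0 : ℝ) 1, ∀ β' ∈ Set.Ioo (0 : ℝ) 1,
      ∃ (m : ℕ) (B : Kernel (Fin m → X × Bool) 𝒞),
        IsMarkovKernel B ∧
        (m : ℝ) ≤ C * boostCost γ ε β' ρ' (n (β' * ε * γ ^ 2 / 6) (ρ' * ε * γ ^ 2 / 6)) *
          (1 + Real.log (1 / (ε * γ * ρ'))) ^ k ∧
        ∀ D : Measure (X × Bool), IsProbabilityMeasure D → IsWeakLearnerOn γ A P D →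
          TVIndistinguishable B D ρ' ∧ Accurate B D ε β' := by
  refine ⟨3000000, 2, fun {X} _ 𝒞 h𝒞 γ hγ n A P hA _ ρ hρ ε hε β hβ => ?_⟩
  have hγ0 := hγ.1
  have hε0 := hε.1
  have hρ0 := hρ.1
  have hβ0 := hβ.1
  have hq0 : 0 < ε * γ ^ 2 := by positivity
  have hγ2 : γ ^ 2 < 1 := by nlinarith [hγ.2]
  have hq1 : ε * γ ^ 2 < 1 := by nlinarith [hε.2, sq_nonneg γ]
  have hεγ : ε * γ < 1 := by nlinarith [hε.2, hγ.2]
  have hℓ : 1 ≤ 1 + Real.log (1 / (ε * γ * ρ)) := by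
    have := log_one_div_nonneg (x := ε * γ * ρ) ⟨by positivity, by nlinarith [hρ.2, hγ.2]⟩
    linarith
  have hl : 1 ≤ 1 + Real.log (1 / β) := by linarith [log_one_div_nonneg hβ]
  rcases isEmpty_or_nonempty X with hX | ⟨⟨x₀⟩⟩
  -- An empty `X` carries no data distribution, so any rule works. Otherwise a point of `X` supplies
  -- the filler example for rejection sampling.
  · have c₀ : 𝒞 := ⟨_, h𝒞.boolean_closed 0 (fun _ => false) (fun i => i.elim0) fun i => i.elim0⟩
    refine ⟨0, Kernel.const _ (Measure.dirac c₀), inferInstance, ?_, fun D hD => ?_⟩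
    · have : 0 ≤ boostCost γ ε β ρ (n (β * ε * γ ^ 2 / 6) (ρ * ε * γ ^ 2 / 6)) := by
        unfold boostCost; positivity
      push_cast
      positivity
    · exact absurd hD.measure_univ (by simp [Set.univ_eq_empty_iff.2 (inferInstance :
        IsEmpty (X × Bool))])
  set β₀ := β * ε * γ ^ 2 / 6 with hβ₀
  set ρ₀ := ρ * ε * γ ^ 2 / 6 with hρ₀
  set N := n β₀ ρ₀
  have hβq : β * (ε * γ ^ 2) < 1 := by nlinarith [hβ.2]
  have hρq : ρ * (ε * γ ^ 2) < 1 := by nlinarith [hρ.2]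
  have hβ₀m : β₀ ∈ Set.Ioo (0 : ℝ) 1 := ⟨by positivity, by rw [hβ₀]; linarith⟩
  have hρ₀m : ρ₀ ∈ Set.Ioo (0 : ℝ) 1 := ⟨by positivity, by rw [hρ₀]; linarith⟩
  have hAm : IsMarkovKernel (A β₀ ρ₀) := hA _ _
  set δ := β * ρ * ε * γ ^ 2 / 100 with hδ
  have hδ0 : 0 < δ := by positivity
  -- As `T ≤ 3 / (ε * γ²)`, this gives `T * s ≤ 3 / 4`, so the floors of all the tests together cost
  -- less than one `c`. Likewise `T * β₀ ≤ β / 2` and `T * ρ₀ ≤ ρ / 2`.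
  set s := ε * γ ^ 2 / 4 with hs
  have hs0 : 0 < s := by positivity
  set a := Real.log (1 / δ) with ha
  set b := Real.log ((1 + s) / s) with hb
  -- Steps of size `γ * ε / 4` must cover the range of the potential, which is less than `1 / (2 *
  -- γ)`.
  set T := ⌈2 / (ε * γ ^ 2)⌉₊ with hT
  set M₁ := ⌈8 / ε * (N + a)⌉₊ with hM₁
  -- The first summand makes the test stable with `L = 80 / ρ`, the second makes its Hoeffding error
  -- at most `δ`.
  set M₂ := ⌈(80 / ρ) ^ 2 * (4 / ε * b) ^ 2 + 8 / ε ^ 2 * a⌉₊ with hM₂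
  have hb0 : 0 ≤ b := Real.log_nonneg ((one_le_div hs0).2 (by linarith))
  have hbpos : 0 < b := Real.log_pos ((one_lt_div hs0).2 (by linarith))
  have hδ1 : δ < 1 := by
    have : β * ρ * (ε * γ ^ 2) < 1 := by nlinarith [hβ.2, hρ.2, mul_pos hβ0 hρ0]
    rw [hδ]; linarith
  have ha0 : 0 ≤ a := log_one_div_nonneg ⟨hδ0, hδ1⟩
  have hM₂le : (80 / ρ) ^ 2 * (4 / ε * b) ^ 2 + 8 / ε ^ 2 * a ≤ M₂ := Nat.le_ceil _
  have hM₁le : 8 / ε * (N + a) ≤ M₁ := Nat.le_ceil _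
  have hTle : 2 / (ε * γ ^ 2) ≤ T := Nat.le_ceil _
  have hM₂pos : 0 < M₂ := Nat.ceil_pos.2 (by positivity)
  have hTq : (T : ℝ) * (ε * γ ^ 2) ≤ 3 := by
    have h1 := Nat.ceil_lt_add_one (show 0 ≤ 2 / (ε * γ ^ 2) by positivity)
    calc (T : ℝ) * (ε * γ ^ 2) ≤ (2 / (ε * γ ^ 2) + 1) * (ε * γ ^ 2) := by gcongr
      _ = 2 + ε * γ ^ 2 := by field_simp
      _ ≤ 3 := by linarith
  have hT0 : (0 : ℝ) ≤ T := Nat.cast_nonneg T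
  have hδ₁ := two_pow_mul_ofReal_pow_le hε0 hε.2 hδ0 hM₁le
  have hδ₂ : ENNReal.ofReal (Real.exp (-M₂ * ε ^ 2 / 8)) ≤ ENNReal.ofReal δ :=
    ENNReal.ofReal_le_ofReal (exp_neg_mul_le hε0 hδ0 (le_trans (le_add_of_nonneg_left (by positivity)) hM₂le))
  have hBm := isMarkovKernel_boostKernel (h𝒞 := h𝒞) (s := s) (ε := ε) (e₀ := (x₀, true))
    (A := A β₀ ρ₀) (M₁ := M₁) (M₂ := M₂) hγ T 0
  set h₀ : Fin 0 → 𝒞 := fun i => i.elim0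
  refine ⟨boostSamples M₁ M₂ T, (boostKernel h𝒞 γ s ε (x₀, true) (A β₀ ρ₀) M₁ M₂ T 0).comap
    (fun S => (h₀, S)) measurable_prodMk_left, inferInstance, ?_, fun D hD hW => ⟨?_, ?_⟩⟩
  · rw [boostSamples_eq, boostCost]
    push_cast
    refine samples_le hγ hε hρ hl hℓ hT0 ((le_div_iff₀ hq0).2 hTq) hb0
      (log_inv_failure_le hγ hε hβ hρ) (log_stop_le hγ hε hρ) ?_ ?_
    · exact (Nat.ceil_lt_add_one (by positivity)).le
    · exact (Nat.ceil_lt_add_one (by positivity)).le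
  · rw [tvIndistinguishable_iff h𝒞]
    refine (avgTV_boostKernel_le (L := 80 / ρ) hγ hs0 hε0 hM₂pos ?_ ?_ hδ₁ hδ₂
      (r := ENNReal.ofReal ρ₀) (fun D' hD' => ?_) T h₀).trans ?_
    · rw [le_div_iff₀ hρ0]; linarith [hρ.2]
    · exact le_trans (le_add_of_nonneg_right (by positivity)) hM₂le
    · have := hD'.1
      exact (tvIndistinguishable_iff h𝒞 _ D' ρ₀).1 (hW β₀ hβ₀m ρ₀ hρ₀m D' hD').1
    -- The budget in units of `ρ` is `3 * (1/6 + 3/100 + 1/40) + 1/10 < 1`: weak learner, failures,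
    -- floors `s`, and the single `c`.
    · have h8 : 8 / (80 / ρ) = ρ / 10 := by field_simp; norm_num
      rw [h8, ← ENNReal.ofReal_natCast T, ← ENNReal.ofReal_ofNat 3,
        ← ENNReal.ofReal_mul (by norm_num), ← ENNReal.ofReal_mul (by positivity),
        ← ENNReal.ofReal_add (by positivity) (by positivity),
        ← ENNReal.ofReal_add (by positivity) (by positivity),
        ← ENNReal.ofReal_mul (by positivity),
        ← ENNReal.ofReal_add (by positivity) (by positivity)]
      refine ENNReal.ofReal_le_ofReal ?_
      have hδρ : δ ≤ ρ * (ε * γ ^ 2) / 100 := by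
        rw [hδ]; nlinarith [mul_pos hρ0 hq0, hβ.2]
      calc (T : ℝ) * (ρ₀ + 3 * δ + ρ / 10 * s) + ρ / 10
          ≤ T * (ρ₀ + 3 * (ρ * (ε * γ ^ 2) / 100) + ρ / 10 * s) + ρ / 10 := by gcongr
        _ = T * (ε * γ ^ 2) * (ρ * (1 / 6 + 3 / 100 + 1 / 40)) + ρ / 10 := by
            rw [hρ₀, hs]; ring
        _ ≤ 3 * (ρ * (1 / 6 + 3 / 100 + 1 / 40)) + ρ / 10 := by gcongr
        _ ≤ ρ := by linarith
  · have hacc := lintegral_boostKernel_err_le (e₀ := (x₀, true)) (h𝒞 := h𝒞) (D := D) hγ hs0 hε0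
      hM₂pos hδ₁ hδ₂ (b := ENNReal.ofReal β₀)
      (fun D' hD' => (hW β₀ hβ₀m ρ₀ hρ₀m D' hD').2.1) T h₀ ?_
    · refine le_trans hacc ?_
      rw [← ENNReal.ofReal_natCast T, ← ENNReal.ofReal_ofNat 2,
        ← ENNReal.ofReal_mul (by norm_num), ← ENNReal.ofReal_add (by positivity) (by positivity),
        ← ENNReal.ofReal_mul (by positivity)]
      refine ENNReal.ofReal_le_ofReal ?_
      have hδβ : δ ≤ β * (ε * γ ^ 2) / 100 := by
        rw [hδ]; nlinarith [mul_pos hβ0 hq0, hρ.2]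
      calc (T : ℝ) * (β₀ + 2 * δ) ≤ T * (β₀ + 2 * (β * (ε * γ ^ 2) / 100)) := by gcongr
        _ = T * (ε * γ ^ 2) * (β * (1 / 6 + 2 / 100)) := by rw [hβ₀]; ring
        _ ≤ 3 * (β * (1 / 6 + 2 / 100)) := by gcongr
        _ ≤ β := by linarith
    · rw [avgPotential_zero, sub_neg]
      calc (1 - γ ^ 2) / (2 * γ) < 1 / (2 * γ) := by gcongr; linarith [pow_pos hγ0 2]
        _ = 2 / (ε * γ ^ 2) * (γ * (ε / 4)) := by field_simp; norm_num
        _ ≤ T * (γ * (ε / 4)) := by gcongr
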